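/- Let $\Gamma=SL_2(\mathbb Z)$, $T=\begin{pmatrix}1&1\\0&1\end{pmatrix}$, and let $\rho:\Gamma\to GL_d(\mathbb C)$ ($d\ge1$) be an irreducible representation of finite level $N$ (the order of $\rho(T)$), with $$\rho(T)=\mathrm{diag}\left(e^{2\pi iA_1/N},\dots,e^{2\pi iA_d/N}\right),\qquad A_j\in\mathbb Z,\quad 0\le A_j<N .$$ For $k\in\mathbb Z$ let $\mathcal H(k,\rho)$ be the space of holomorphic $F=(f_1,\dots,f_d)^t:\mathbb H\to\mathbb C^d$ with $F|_k\gamma=\rho(\gamma)F$ for all $\gamma\in\Gamma$ that are of moderate growth at infinity (for some integer $n$, $|f_j(x+iy)|<y^{n}$ for all $j$ and all large $y$, locally uniformly in $x$), and let $\mathcal H(\rho)=\bigoplus_{k\in\mathbb Z}\mathcal H(k,\rho)$. Each $F\in\mathcal H(\rho)$ has an expansion $f_j=\sum_{n\ge0}a_j(n)q^{A_j/N+n}$, $q=e^{2\pi i\tau}$. Let $\mathcal M$ be the graded ring of modular forms for $\Gamma$, let $D$ be the operator that acts on weight $k$ as $D_kf=\frac1{2\pi i}\frac{df}{d\tau}-\frac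 k{12}E_2f$ (where $E_2=1-24\sum_{n\ge1}\sum_{m\mid n}m\,q^n$), and let $\mathcal R=\mathcal M[\partial]$ be the skew polynomial ring with $\partial M=M\partial+DM$ ($M\in\mathcal M$), which acts on $\mathcal H(\rho)$ with $\partial$ acting as $D$. Suppose that $\mathcal H(\rho)=\mathcal RF_0$ is a cyclic $\mathcal R$-module, generated by some $F_0\in\mathcal H(k_0,\rho)$ whose first component is $q^{A_1/N}+\sum_{n\ge1}a(n)q^{A_1/N+n}$ with $a(n)\in\mathbb Q$, and that there are a prime $p$ and an integer $\delta<0$ such that $$\nu_p(a(n))=n\delta-\nu_p\left(\prod_{k=1}^nk\lambda(k)\right)\quad\text{for all }n\ge1,\qquad \lambda(k)=\prod_{j=2}^d\left(Nk+A_1-A_j\right),$$ where $\nu_p$ is the $p$-adic valuation; for $d=3$ and $(A_1,A_2,A_3)=(A,B,C)$ this reads $\lambda(k)=Nk[Nk+(A-B)+(A-C)]+(A-B)(A-C)$. Call an $F\in\mathcal H(\rho)$ whose Fourier coefficients are all rational $p$-UBD if $p$ occurs to an arbitrarily high power in the denominators of the Fourier coefficients of some component of $F$, and let $\mathcal B_p$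 be the set of those $F\in\mathcal H(\rho)$ with rational Fourier coefficients that are not $p$-UBD. Then $\mathcal B_p=\{0\}$; that is, every nonzero $F\in\mathcal H(\rho)$ with rational Fourier coefficients is $p$-UBD. -/

import Mathlib

open UpperHalfPlane
open scoped MatrixGroups ModularForm Manifold

noncomputable section

namespace VVMF

/-- The representation of the modular group on column vectors given by a matrix representation. -/
def toRepresentation {d : ℕ} (ρ : SL(2, ℤ) →* GL (Fin d) ℂ) :
    Representation ℂ SL(2, ℤ) (Fin d → ℂ) :=
  ((Matrix.toLinAlgEquiv' (R := ℂ) (n := Fin d)) :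
      Matrix (Fin d) (Fin d) ℂ →* Module.End ℂ (Fin d → ℂ)).comp
    ((Units.coeHom (Matrix (Fin d) (Fin d) ℂ)).comp ρ)

/-- Moderate growth at infinity: some power of `y` dominates every component of `F (x + iy)` for
large `y`, locally uniformly in `x`. -/
def ModerateGrowth {d : ℕ} (F : ℍ → Fin d → ℂ) : Prop :=
  ∃ N : ℕ, ∀ i : Fin d, ∀ R : ℝ, ∃ Y : ℝ, ∀ τ : ℍ,
    |τ.re| ≤ R → Y ≤ τ.im → ‖F τ i‖ < τ.im ^ N

/-- `F` is a vector-valued modular form of weight `k` for `ρ`: it is holomorphic, of moderate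
growth at infinity, and satisfies `F|_k γ = ρ(γ) F` for all `γ` in `SL(2, ℤ)`. -/
structure IsVVMF {d : ℕ} (ρ : SL(2, ℤ) →* GL (Fin d) ℂ) (k : ℤ) (F : ℍ → Fin d → ℂ) : Prop where
  holo : ∀ i, MDiff (fun τ : ℍ ↦ F τ i)
  growth : ModerateGrowth F
  slash : ∀ (γ : SL(2, ℤ)) (i : Fin d),
    (fun τ : ℍ ↦ F τ i) ∣[k] γ =
      fun τ : ℍ ↦ ((ρ γ : Matrix (Fin d) (Fin d) ℂ).mulVec (F τ)) i

/-- The space `𝓗(k, ρ)` of vector-valued modular forms of weight `k` for `ρ`. -/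
def formSpace {d : ℕ} (ρ : SL(2, ℤ) →* GL (Fin d) ℂ) (k : ℤ) :
    Submodule ℂ (ℍ → Fin d → ℂ) where
  carrier := {F | IsVVMF ρ k F}
  zero_mem' := by
    refine ⟨fun i ↦ mdifferentiable_const, ⟨0, fun i R ↦ ⟨0, fun τ _ _ ↦ ?_⟩⟩, fun γ i ↦ ?_⟩
    · simp
    · ext τ
      simp [ModularForm.SL_slash_apply]
  add_mem' := by
    rintro F G ⟨hF, ⟨NF, gF⟩, sF⟩ ⟨hG, ⟨NG, gG⟩, sG⟩
    refine ⟨fun i ↦ (hF i).add (hG i), ⟨max NF NG + 1, fun i R ↦ ?_⟩, fun γ i ↦ ?_⟩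
    · obtain ⟨YF, hYF⟩ := gF i R
      obtain ⟨YG, hYG⟩ := gG i R
      refine ⟨max 2 (max YF YG), fun τ hre him ↦ ?_⟩
      have h2 : (2 : ℝ) ≤ τ.im := (le_max_left _ _).trans him
      have h1 : (1 : ℝ) ≤ τ.im := by linarith
      have hf := hYF τ hre (((le_max_left _ _).trans (le_max_right _ _)).trans him)
      have hg := hYG τ hre (((le_max_right _ _).trans (le_max_right _ _)).trans him)
      have hf' := hf.trans_le (pow_le_pow_right₀ h1 (le_max_left NF NG))
      have hg' := hg.trans_le (pow_le_pow_right₀ h1 (le_max_right NF NG))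
      have hpos : 0 < τ.im ^ max NF NG := by positivity
      calc ‖(F + G) τ i‖ ≤ ‖F τ i‖ + ‖G τ i‖ := norm_add_le _ _
        _ < τ.im ^ max NF NG * 2 := by linarith
        _ ≤ τ.im ^ max NF NG * τ.im := by gcongr
        _ = τ.im ^ (max NF NG + 1) := (pow_succ _ _).symm
    · ext τ
      have h1 := congrFun (sF γ i) τ
      have h2 := congrFun (sG γ i) τ
      simp only [ModularForm.SL_slash_apply] at h1 h2 ⊢
      simp only [Pi.add_apply, Matrix.mulVec_add, add_mul]
      rw [h1, h2]
  smul_mem' := by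
    rintro c F ⟨hF, ⟨NF, gF⟩, sF⟩
    refine ⟨fun i ↦ (hF i).const_smul c, ⟨NF + 1, fun i R ↦ ?_⟩, fun γ i ↦ ?_⟩
    · obtain ⟨YF, hYF⟩ := gF i R
      refine ⟨max (‖c‖ + 1) YF, fun τ hre him ↦ ?_⟩
      have hc : ‖c‖ < τ.im := by
        have := (le_max_left _ _).trans him
        linarith
      have hf := hYF τ hre ((le_max_right _ _).trans him)
      have hpos : 0 < τ.im ^ NF := pow_pos τ.im_pos _
      calc ‖(c • F) τ i‖ = ‖c‖ * ‖F τ i‖ := norm_mul _ _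
        _ ≤ ‖c‖ * τ.im ^ NF := by gcongr
        _ < τ.im * τ.im ^ NF := by gcongr
        _ = τ.im ^ (NF + 1) := by ring
    · ext τ
      have h1 := congrFun (sF γ i) τ
      simp only [ModularForm.SL_slash_apply] at h1 ⊢
      simp only [Pi.smul_apply, Matrix.mulVec_smul, smul_eq_mul, mul_assoc]
      rw [h1]

/-- The space `𝓗(ρ)` of vector-valued modular forms of all integral weights: the finite sums of
elements of the spaces `𝓗(k, ρ)`. -/
def formModule {d : ℕ} (ρ : SL(2, ℤ) →* GL (Fin d) ℂ) : Submodule ℂ (ℍ → Fin d → ℂ) :=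
  ⨆ k : ℤ, formSpace ρ k

/-- The iterated modular derivative `D_k^n = D_{k+2(n-1)} ∘ ⋯ ∘ D_k`, acting componentwise, where
`D_k f = (2πi)⁻¹ df/dτ - (k/12) E₂ f`. -/
def modularDeriv {d : ℕ} (k : ℤ) : ℕ → (ℍ → Fin d → ℂ) → ℍ → Fin d → ℂ
  | 0, F => F
  | n + 1, F => fun τ i ↦
      Derivative.serreDerivative ((k : ℂ) + 2 * (n : ℂ)) (fun z ↦ modularDeriv k n F z i) τ

/-- The submodule `𝓡 F` generated by a vector `F` of weight `k` over the skew polynomial ring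
`𝓡 = 𝓜[∂]`, in which `𝓜`, the graded ring of modular forms for `SL(2, ℤ)`, acts by multiplication
and `∂ʲ` by the `j`-th power of the modular derivative: the finite sums of the `g · D_k^j F`. -/
def cyclicModule {d : ℕ} (k : ℤ) (F : ℍ → Fin d → ℂ) : Submodule ℂ (ℍ → Fin d → ℂ) :=
  Submodule.span ℂ {G | ∃ (j : ℕ) (w : ℤ) (g : ModularForm 𝒮ℒ w),
    G = fun τ ↦ g τ • modularDeriv k j F τ}

/-- `f(τ) = ∑_{n ≥ 0} a(n) q^{r + n}` on the upper half-plane, where `q^s = e^{2πisτ}`. -/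
def HasQSeries (r : ℝ) (f : ℍ → ℂ) (a : ℕ → ℂ) : Prop :=
  ∀ τ : ℍ, HasSum
    (fun n : ℕ ↦ a n * Complex.exp (2 * Real.pi * Complex.I * ((r : ℂ) + n) * (τ : ℂ))) (f τ)

/-- The `i`-th component of `F` is `∑_{n ≥ 0} a_i(n) q^{r_i + n}` with rational `a_i(n)`. -/
def HasRationalQSeries {d : ℕ} (r : Fin d → ℝ) (F : ℍ → Fin d → ℂ) (a : Fin d → ℕ → ℚ) : Prop :=
  ∀ i, HasQSeries (r i) (fun τ ↦ F τ i) (fun n ↦ (a i n : ℂ))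

/-- `𝓗(ρ)_ℚ`: the elements of `𝓗(ρ)` with rational Fourier coefficients, where `r` is the vector
of exponents of `ρ(T)`. -/
def rationalForms {d : ℕ} (ρ : SL(2, ℤ) →* GL (Fin d) ℂ) (r : Fin d → ℝ) :
    Set (ℍ → Fin d → ℂ) :=
  {F | F ∈ formModule ρ ∧ ∃ a : Fin d → ℕ → ℚ, HasRationalQSeries r F a}

/-- `F` has rational Fourier coefficients and is `p`-UBD: `p` occurs to an arbitrarily high power
in the denominators of the Fourier coefficients of some component of `F`. -/
def IsPUBD {d : ℕ} (p : ℕ) (r : Fin d → ℝ) (F : ℍ → Fin d → ℂ) : Prop :=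
  ∃ a : Fin d → ℕ → ℚ, HasRationalQSeries r F a ∧
    ∃ i, ∀ m : ℕ, ∃ n : ℕ, p ^ m ∣ (a i n).den

/-- `𝓑_p`: the `p`-bounded vectors in `𝓗(ρ)_ℚ`, that is, those which are not `p`-UBD. -/
def pBoundedForms {d : ℕ} (ρ : SL(2, ℤ) →* GL (Fin d) ℂ) (p : ℕ) (r : Fin d → ℝ) :
    Set (ℍ → Fin d → ℂ) :=
  {F | F ∈ rationalForms ρ r ∧ ¬ IsPUBD p r F}

/-- The integers `λ(n) = ∏_{i > 0} (N n + A₀ - Aᵢ)`. For three exponents `A/N, B/N, C/N` this is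
`λ(n) = N n (N n + (A - B) + (A - C)) + (A - B) (A - C)`. -/
def lam {d : ℕ} [NeZero d] (N : ℕ) (A : Fin d → ℕ) (n : ℕ) : ℤ :=
  ∏ i ∈ Finset.univ.erase (0 : Fin d), ((N : ℤ) * n + A 0 - A i)

end VVMF

end

/-! ### Fractional `q`-series: uniqueness, products, termwise derivatives. -/

namespace VVMF

open Derivative PowerSeries

/-! Let `F` be a nonzero form with rational coefficients, and suppose that its first component has
`p`-bounded coefficients. The argument expresses `F₀` through derivatives of `F` and contradicts the
growth of the `a n`.

Since `ρ` is irreducible, the components of `F` are linearly independent (`linearForm_eq_zero`), so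
some `d` iterated `q d/dq`-derivatives of `F` have nonzero determinant `W` at a point. Cyclicity
keeps these derivatives in the span of vector-valued forms over `qAlg`, an algebra containing the
level one forms and `E₂` and stable under differentiation (`vecDeriv_mem_vecSpan`). Cramer's rule
writes `W · F₀` in terms of the derivatives; all determinants involved carry the character `det ρ`,
of order dividing 12, so multiplying by `W ^ 11` puts every coefficient in `qAlg`
(`exists_relation`).

Elements of `qAlg` are complex combinations of integral `q`-series. A `ℚ`-linear map `ℂ → ℚ` applied
to the coefficients therefore gives a relation `P * a = ∑ S t * b t` over `ℚ`, with `P ≠ 0` and `P`,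
`S t` `p`-bounded (`exists_rational_relation`). The `b t` are Euler derivatives of the first
component of `F`, so the right side is `p`-bounded. The left side is not: `|a (n + 1)|` exceeds `|a
n|` by a factor at least `p / |n + 1|`, which is arbitrarily large at `n + 1 = p ^ t`
(`not_pBounded_mul`). -/

lemma HasQSeries.congr {r : ℝ} {f g : ℍ → ℂ} {a b : ℕ → ℂ} (hf : HasQSeries r f a)
    (hfg : f = g) (hab : ∀ n, a n = b n) : HasQSeries r g b := by
  obtain rfl := hfg
  obtain rfl := funext hab
  exact hf

lemma hasQSeries_zero_iff {f : ℍ → ℂ} {a : ℕ → ℂ} :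
    HasQSeries 0 f a ↔ ∀ τ : ℍ, HasSum (fun n ↦ a n • Function.Periodic.qParam 1 τ ^ n) (f τ) := by
  refine forall_congr' fun τ ↦ ?_
  have : (fun n : ℕ ↦ a n * Complex.exp (2 * Real.pi * Complex.I * (((0 : ℝ) : ℂ) + n) * (τ : ℂ)))
      = fun n ↦ a n • Function.Periodic.qParam 1 τ ^ n := by
    ext n
    rw [Function.Periodic.qParam, ← Complex.exp_nat_mul, smul_eq_mul]
    congr 2
    push_cast
    ring
  rw [this]

lemma HasQSeries.shift {r : ℝ} {f : ℍ → ℂ} {a : ℕ → ℂ} (hf : HasQSeries r f a) (s : ℝ) :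
    HasQSeries (r + s) (fun τ ↦ f τ * Complex.exp (2 * Real.pi * Complex.I * s * (τ : ℂ))) a := by
  intro τ
  convert! (hf τ).mul_right (Complex.exp (2 * Real.pi * Complex.I * s * (τ : ℂ))) using 2 with n
  rw [mul_assoc (a n), ← Complex.exp_add]
  congr 2
  push_cast
  ring

lemma HasQSeries.add {r : ℝ} {f g : ℍ → ℂ} {a b : ℕ → ℂ} (hf : HasQSeries r f a)
    (hg : HasQSeries r g b) : HasQSeries r (f + g) (fun n ↦ a n + b n) := by
  intro τ
  convert! (hf τ).add (hg τ) using 2 with n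
  exact add_mul _ _ _

lemma HasQSeries.const_smul {r : ℝ} {f : ℍ → ℂ} {a : ℕ → ℂ} (c : ℂ) (hf : HasQSeries r f a) :
    HasQSeries r (c • f) (fun n ↦ c * a n) := by
  intro τ
  convert! (hf τ).mul_left c using 2 with n
  exact mul_assoc _ _ _

/-- Multiplying by `q ^ (-r)` reduces to `r = 0`, where uniqueness of the expansion of the zero
modular form applies. -/
lemma HasQSeries.eq_zero {r : ℝ} {a : ℕ → ℂ} (h : HasQSeries r 0 a) (n : ℕ) : a n = 0 := by
  have h0 : HasQSeries 0 0 a := by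
    have := h.shift (-r)
    rw [add_neg_cancel] at this
    exact this.congr (by ext; simp) fun _ ↦ rfl
  have h1 := ModularFormClass.qExpansion_coeff_unique (f := (0 : ModularForm 𝒮ℒ 0)) one_pos
    one_mem_strictPeriods_SL (hasQSeries_zero_iff.mp h0) n
  have h2 : qExpansion 1 (⇑(0 : ModularForm 𝒮ℒ 0)) = 0 := qExpansion_zero 1
  rw [h1, h2, map_zero]

lemma HasQSeries.unique {r : ℝ} {f : ℍ → ℂ} {a b : ℕ → ℂ} (ha : HasQSeries r f a)
    (hb : HasQSeries r f b) (n : ℕ) : a n = b n := by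
  have h : HasQSeries r 0 (fun n ↦ a n + (-1) * b n) :=
    (ha.add (hb.const_smul (-1))).congr (by simp) fun _ ↦ rfl
  linear_combination h.eq_zero n

lemma HasQSeries.mul {r s : ℝ} {f g : ℍ → ℂ} {P Q : ℂ⟦X⟧} (hf : HasQSeries r f (P.coeff ·))
    (hg : HasQSeries s g (Q.coeff ·)) : HasQSeries (r + s) (f * g) ((P * Q).coeff ·) := by
  intro τ
  have hfs := (hf τ).summable.norm
  have hgs := (hg τ).summable.norm
  have h := (summable_norm_sum_mul_antidiagonal_of_summable_norm hfs hgs).of_norm.hasSum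
  rw [← tsum_mul_tsum_eq_tsum_sum_antidiagonal_of_summable_norm hfs hgs, (hf τ).tsum_eq,
    (hg τ).tsum_eq] at h
  convert! h using 2 with n
  dsimp only
  rw [coeff_mul, Finset.sum_mul]
  refine Finset.sum_congr rfl fun ⟨i, j⟩ hij ↦ ?_
  obtain rfl : i + j = n := by simpa using hij
  rw [mul_mul_mul_comm, ← Complex.exp_add]
  congr 2
  push_cast
  ring

/-- Termwise differentiation needs locally uniform convergence. Once `r + n ≥ 0`, the terms decrease
in norm with `Im z`, so on `Im z > y` they are dominated by their values at `iy`. The finitely many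
terms with `n < n₀` are split off because `r` may be negative. -/
lemma HasQSeries.normalizedDeriv {r : ℝ} {f : ℍ → ℂ} {a : ℕ → ℂ} (hf : HasQSeries r f a) :
    HasQSeries r (normalizedDerivOfComplex f) (fun n ↦ (r + n) * a n) := by
  intro τ
  set y : ℝ := τ.im / 2 with hy
  have hy0 : 0 < y := half_pos τ.im_pos
  let U : Set ℂ := {z | y < z.im}
  have hU : IsOpen U := isOpen_lt continuous_const Complex.continuous_im
  have hτ : (τ : ℂ) ∈ U := by
    change y < τ.im
    rw [hy]
    linarith [τ.im_pos]
  let G : ℕ → ℂ → ℂ := fun n z ↦ a n * Complex.exp (2 * Real.pi * Complex.I * ((r : ℂ) + n) * z)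
  have hnorm (n : ℕ) (z : ℂ) : ‖G n z‖ = ‖a n‖ * Real.exp (-(2 * Real.pi * ((r + n) * z.im))) := by
    simp only [G, norm_mul, Complex.norm_exp]
    congr 2
    simp [Complex.mul_re, Complex.mul_im, mul_assoc]
  let τ₀ : ℍ := ⟨⟨0, y⟩, hy0⟩
  obtain ⟨n₀, hn₀⟩ := exists_nat_ge (-r)
  have hs : Summable fun n ↦ ‖G n τ₀‖ := (hf τ₀).summable.norm
  have hG (n : ℕ) (z : ℂ) : HasDerivAt (G n) (2 * Real.pi * Complex.I * ((r + n) * G n z)) z := by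
    have h1 : HasDerivAt (fun z : ℂ ↦ 2 * Real.pi * Complex.I * ((r : ℂ) + n) * z)
        (2 * Real.pi * Complex.I * ((r : ℂ) + n)) z := by
      simpa using (hasDerivAt_id z).const_mul (2 * Real.pi * Complex.I * ((r : ℂ) + n))
    convert! (h1.cexp).const_mul (a n) using 1
    simp only [G]
    ring
  have hsub : ∀ z ∈ U, 0 < z.im := fun z hz ↦ hy0.trans hz
  have hle (n : ℕ) (z : ℂ) (hz : z ∈ U) : ‖G (n + n₀) z‖ ≤ ‖G (n + n₀) τ₀‖ := by
    rw [hnorm, hnorm]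
    gcongr ?_ * Real.exp (-(2 * Real.pi * ?_))
    have : (0 : ℝ) ≤ r + ↑(n + n₀) := by
      push_cast
      linarith [(Nat.cast_nonneg n : (0 : ℝ) ≤ n)]
    exact mul_le_mul_of_nonneg_left (le_of_lt hz) this
  have hdiff (n : ℕ) : DifferentiableOn ℂ (G (n + n₀)) U :=
    fun z _ ↦ (hG _ z).differentiableAt.differentiableWithinAt
  have hs' := (summable_nat_add_iff n₀).mpr hs
  have htail := Complex.hasSum_deriv_of_summable_norm hs' hdiff hU hle hτ
  have hfeq : ∀ z ∈ U, (f ∘ ofComplex) z = ∑ n ∈ Finset.range n₀, G n z + ∑' n, G (n + n₀) z := by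
    intro z hz
    have h1 := hf ⟨z, hsub z hz⟩
    rw [Function.comp_apply, ofComplex_apply_of_im_pos (hsub z hz), ← h1.tsum_eq]
    exact (h1.summable.sum_add_tsum_nat_add n₀).symm
  have htd : DifferentiableAt ℂ (fun z ↦ ∑' n, G (n + n₀) z) τ :=
    (Complex.differentiableOn_tsum_of_summable_norm hs' hdiff hU hle).differentiableAt
      (hU.mem_nhds hτ)
  have hder : deriv (f ∘ ofComplex) τ =
      ∑ n ∈ Finset.range n₀, deriv (G n) τ + deriv (fun z ↦ ∑' n, G (n + n₀) z) τ := by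
    rw [(Filter.eventuallyEq_of_mem (hU.mem_nhds hτ) hfeq).deriv_eq, deriv_fun_add _ htd,
      deriv_fun_sum]
    · exact fun n _ ↦ (hG n _).differentiableAt
    · exact DifferentiableAt.fun_sum fun n _ ↦ (hG n _).differentiableAt
  have hsum : HasSum (fun n ↦ deriv (G n) τ) (deriv (f ∘ ofComplex) τ) := by
    rw [hder, add_comm]
    exact (hasSum_nat_add_iff n₀).mp htail
  have h2 := hsum.mul_left (2 * Real.pi * Complex.I)⁻¹
  convert! h2 using 2 with n
  rw [(hG n τ).deriv, inv_mul_cancel_left₀ Complex.two_pi_I_ne_zero]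
  exact mul_assoc _ _ _

/-! ### Complex combinations of integral `q`-series; level one forms and `E₂`. -/

/-- The complex span of the power series with integral coefficients. -/
noncomputable def intSpan : Subalgebra ℂ ℂ⟦X⟧ :=
  Algebra.adjoin ℂ (Set.range (PowerSeries.map (Int.castRingHom ℂ)))

lemma map_intCast_mem_intSpan (P : ℤ⟦X⟧) : PowerSeries.map (Int.castRingHom ℂ) P ∈ intSpan :=
  Algebra.subset_adjoin ⟨P, rfl⟩

lemma mk_intCast_mem_intSpan (z : ℕ → ℤ) : PowerSeries.mk (fun n ↦ (z n : ℂ)) ∈ intSpan := by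
  convert! map_intCast_mem_intSpan (PowerSeries.mk z) using 1

/-- Integral series are closed under multiplication, so the algebra they generate is their linear
span. This makes linear induction available. -/
lemma intSpan_toSubmodule :
    Subalgebra.toSubmodule intSpan =
      Submodule.span ℂ (Set.range (PowerSeries.map (Int.castRingHom ℂ))) := by
  rw [intSpan, Algebra.adjoin_eq_span]
  congr 1
  have h := Submonoid.closure_eq (MonoidHom.mrange
    (PowerSeries.map (Int.castRingHom ℂ) : ℤ⟦X⟧ →* ℂ⟦X⟧))
  have := congrArg (fun S : Submonoid ℂ⟦X⟧ ↦ (S : Set ℂ⟦X⟧)) h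
  simp

lemma intSpan_induction {p : ℂ⟦X⟧ → Prop}
    (int : ∀ P : ℤ⟦X⟧, p (PowerSeries.map (Int.castRingHom ℂ) P)) (zero : p 0)
    (add : ∀ P Q, p P → p Q → p (P + Q)) (smul : ∀ (c : ℂ) P, p P → p (c • P))
    {P : ℂ⟦X⟧} (hP : P ∈ intSpan) : p P := by
  rw [← Subalgebra.mem_toSubmodule, intSpan_toSubmodule] at hP
  induction hP using Submodule.span_induction with
  | mem x hx =>
    obtain ⟨P, rfl⟩ := hx
    exact int P
  | zero => exact zero
  | add x y _ _ hx hy => exact add x y hx hy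
  | smul c x _ hx => exact smul c x hx

lemma euler_mem_intSpan {P : ℂ⟦X⟧} (hP : P ∈ intSpan) :
    PowerSeries.mk (fun n ↦ (n : ℂ) * P.coeff n) ∈ intSpan := by
  refine intSpan_induction (p := fun P ↦ PowerSeries.mk (fun n ↦ (n : ℂ) * P.coeff n) ∈ intSpan)
    (fun P ↦ ?_) ?_ (fun P Q hP hQ ↦ ?_) (fun c P hP ↦ ?_) hP
  · convert! mk_intCast_mem_intSpan (fun n ↦ n * P.coeff n) using 1
    ext n
    simp
  · convert! intSpan.zero_mem using 1
    ext n
    simp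
  · convert! intSpan.add_mem hP hQ using 1
    ext n
    simp [mul_add]
  · convert! intSpan.smul_mem hP c using 1
    ext n
    simp [mul_left_comm]

/-- The holomorphic functions on the upper half plane whose `q`-series is a complex
combination of power series in `q` with integral coefficients. -/
noncomputable def qAlg : Subalgebra ℂ (ℍ → ℂ) where
  carrier := {f | MDiff f ∧ ∃ P ∈ intSpan, HasQSeries 0 f (P.coeff ·)}
  mul_mem' := by
    rintro f g ⟨hf, P, hP, hfP⟩ ⟨hg, Q, hQ, hgQ⟩
    refine ⟨hf.mul hg, P * Q, intSpan.mul_mem hP hQ, ?_⟩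
    simpa using hfP.mul hgQ
  add_mem' := by
    rintro f g ⟨hf, P, hP, hfP⟩ ⟨hg, Q, hQ, hgQ⟩
    exact ⟨hf.add hg, P + Q, intSpan.add_mem hP hQ, (hfP.add hgQ).congr rfl (by simp)⟩
  algebraMap_mem' c := by
    refine ⟨mdifferentiable_const, algebraMap ℂ ℂ⟦X⟧ c, intSpan.algebraMap_mem c,
      hasQSeries_zero_iff.mpr fun τ ↦ ?_⟩
    have := hasSum_single (f := fun n ↦ (algebraMap ℂ ℂ⟦X⟧ c).coeff n •
      Function.Periodic.qParam 1 τ ^ n) 0 (fun n hn ↦ by simp [coeff_C, hn])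
    simpa using this

lemma qAlg_normalizedDeriv {f : ℍ → ℂ} (hf : f ∈ qAlg) : normalizedDerivOfComplex f ∈ qAlg := by
  obtain ⟨hf, P, hP, hfP⟩ := hf
  exact ⟨normalizedDerivOfComplex_mdifferentiable hf, _, euler_mem_intSpan hP,
    hfP.normalizedDeriv.congr rfl fun n ↦ by simp⟩

lemma E2_mem_qAlg : EisensteinSeries.E2 ∈ qAlg := by
  refine ⟨E2_mdifferentiable, _, mk_intCast_mem_intSpan
    (fun m ↦ if m = 0 then 1 else -24 * (ArithmeticFunction.sigma 1 m : ℕ)),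
    hasQSeries_zero_iff.mpr fun τ ↦ ?_⟩
  convert! EisensteinSeries.hasSum_qExpansion_E2 (z := τ) using 2 with m
  by_cases h : m = 0 <;> simp [h, Function.Periodic.qParam]

lemma modularForm_hasQSeries {k : ℤ} (f : ModularForm 𝒮ℒ k) :
    HasQSeries 0 f ((qExpansion 1 f).coeff ·) :=
  hasQSeries_zero_iff.mpr fun τ ↦
    ModularForm.hasSum_qExpansion f one_pos one_mem_strictPeriods_SL τ

lemma eisenstein_mem_qAlg {k : ℕ} (hk : 3 ≤ k) (hk2 : Even k) :
    (ModularForm.E hk : ℍ → ℂ) ∈ qAlg := by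
  refine ⟨ModularFormClass.holo _, _, ?_, modularForm_hasQSeries _⟩
  have : qExpansion 1 (ModularForm.E hk) = 1 + (-(2 * k / bernoulli k : ℂ)) •
      PowerSeries.mk (fun m ↦ (((if m = 0 then 0 else
        (ArithmeticFunction.sigma (k - 1) m : ℕ)) : ℤ) : ℂ)) := by
    ext m
    rw [EisensteinSeries.E_qExpansion_coeff hk hk2]
    by_cases h : m = 0 <;> simp [h, coeff_one]
  rw [this]
  exact intSpan.add_mem intSpan.one_mem (intSpan.smul_mem (mk_intCast_mem_intSpan _) _)

/-- Complex scalars are allowed, so the factor `1728⁻¹` in the formula by `E₄` and `E₆` costs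
nothing. -/
lemma discriminant_mem_qAlg : ModularForm.discriminant ∈ qAlg := by
  have : ModularForm.discriminant = (1728 : ℂ)⁻¹ •
      ((ModularForm.E₄ : ℍ → ℂ) ^ 3 - (ModularForm.E₆ : ℍ → ℂ) ^ 2) := by
    ext z
    rw [ModularForm.discriminant_eq_E₄_cube_sub_E₆_sq]
    simp
    ring
  rw [this]
  exact qAlg.smul_mem (qAlg.sub_mem (qAlg.pow_mem (eisenstein_mem_qAlg _ ⟨2, rfl⟩) _)
    (qAlg.pow_mem (eisenstein_mem_qAlg _ ⟨3, rfl⟩) _)) _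

/-- Level one modular forms are complex combinations of forms with integral `q`-series. -/
lemma modularForm_mem_qAlg (k : ℤ) (f : ModularForm 𝒮ℒ k) : (f : ℍ → ℂ) ∈ qAlg := by
  rcases lt_or_ge k 0 with hk | hk
  · rw [ModularFormClass.levelOne_neg_weight_eq_zero hk f]
    exact qAlg.zero_mem
  lift k to ℕ using hk
  induction k using Nat.strong_induction_on with | _ k ih =>
  rcases Nat.even_or_odd k with hk2 | hodd
  swap
  · rw [ModularForm.levelOne_odd_weight_eq_zero (mod_cast hodd) f]
    exact qAlg.zero_mem
  rcases lt_or_ge k 3 with hk3 | hk3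
  · interval_cases k
    · obtain ⟨c, hc⟩ := ModularFormClass.levelOne_weight_zero_const f
      rw [hc]
      exact qAlg.algebraMap_mem c
    · exact absurd hk2 (by decide)
    · rw [rank_zero_iff_forall_zero.mp ModularForm.levelOne_weight_two_rank_zero f]
      exact qAlg.zero_mem
  -- Subtracting `c · E_k` leaves a cusp form, which is the discriminant times a form of weight `k -
  -- 12`; the induction applies to that quotient.
  · set c := (qExpansion 1 f).coeff 0 with hc
    let g : ModularForm 𝒮ℒ k := f - c • ModularForm.E hk3
    have hg : (qExpansion 1 g).coeff 0 = 0 := by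
      simp only [g]
      rw [FunLike.coe_sub, ModularForm.qExpansion_sub one_pos one_mem_strictPeriods_SL,
        FunLike.coe_smul, ModularForm.qExpansion_smul one_pos one_mem_strictPeriods_SL, map_sub,
        PowerSeries.coeff_smul, EisensteinSeries.E_qExpansion_coeff_zero hk3 hk2]
      simp [hc]
    have hfg : (f : ℍ → ℂ) = ModularForm.discriminant *
        (CuspForm.discriminantEquiv (ModularForm.toCuspForm g hg) : ℍ → ℂ) +
        c • (ModularForm.E hk3 : ℍ → ℂ) := by
      rw [ModularForm.discriminant_mul_discriminantEquiv]
      ext z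
      simp [g]
    rw [hfg]
    refine qAlg.add_mem (qAlg.mul_mem discriminant_mem_qAlg ?_)
      (qAlg.smul_mem (eisenstein_mem_qAlg hk3 hk2) c)
    rcases lt_or_ge k 12 with h12 | h12
    · rw [ModularFormClass.levelOne_neg_weight_eq_zero (by lia)
        (CuspForm.discriminantEquiv (ModularForm.toCuspForm g hg))]
      exact qAlg.zero_mem
    · exact ih (k - 12) (by lia) (ModularForm.mcast (by lia)
        (CuspForm.discriminantEquiv (ModularForm.toCuspForm g hg)))

end VVMF

/-! ### Scalar forms with a character. -/

namespace VVMF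

open Derivative PowerSeries ModularGroup

/-- Characters of the modular group have order dividing `12`. -/
lemma character_pow_twelve (χ : SL(2, ℤ) →* ℂ) : χ ^ 12 = 1 := by
  -- The relations `S ^ 4 = 1` and `(S * T) ^ 3 = S ^ 2` give `χ S * χ T ^ 3 = 1`, whence `χ T ^ 12
  -- = (χ S)⁻¹ ^ 4 = 1`.
  have hS4 : χ S ^ 4 = 1 := by
    rw [← map_pow, show S ^ 4 = 1 by decide, map_one]
  have hST : (χ S * χ T) ^ 3 = χ S ^ 2 := by
    rw [← map_mul, ← map_pow, ← map_pow, show (S * T) ^ 3 = S ^ 2 by decide]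
  have hT : χ S * χ T ^ 3 = 1 := by
    linear_combination (χ S ^ 2) * hST + (1 - χ S * χ T ^ 3) * hS4
  have hT12 : χ T ^ 12 = 1 := by
    linear_combination (-χ T ^ 12) * hS4 + ((χ S * χ T ^ 3) ^ 3 + (χ S * χ T ^ 3) ^ 2 +
      χ S * χ T ^ 3 + 1) * hT
  refine MonoidHom.eq_of_eqOn_dense (s := {S, T})
    SpecialLinearGroup.SL2Z_generators ?_
  rintro γ (rfl | rfl)
  · simp only [MonoidHom.pow_apply, MonoidHom.one_apply]
    linear_combination (χ S ^ 8 + χ S ^ 4 + 1) * hS4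
  · simpa using hT12

/-- Holomorphic functions of moderate growth that transform in weight `k` under the modular group
by the character `χ`. -/
structure IsCharForm (χ : SL(2, ℤ) →* ℂ) (k : ℤ) (g : ℍ → ℂ) : Prop where
  holo : MDiff g
  growth : ∃ M : ℕ, ∀ R : ℝ, ∃ C Y : ℝ, ∀ τ : ℍ, |τ.re| ≤ R → Y ≤ τ.im → ‖g τ‖ ≤ C * τ.im ^ M
  slash : ∀ γ : SL(2, ℤ), g ∣[k] γ = fun τ ↦ χ γ * g τ

lemma IsCharForm.mul {χ₁ χ₂ : SL(2, ℤ) →* ℂ} {k₁ k₂ : ℤ} {g₁ g₂ : ℍ → ℂ}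
    (h₁ : IsCharForm χ₁ k₁ g₁) (h₂ : IsCharForm χ₂ k₂ g₂) :
    IsCharForm (χ₁ * χ₂) (k₁ + k₂) (g₁ * g₂) where
  holo := h₁.holo.mul h₂.holo
  growth := by
    obtain ⟨M₁, hM₁⟩ := h₁.growth
    obtain ⟨M₂, hM₂⟩ := h₂.growth
    refine ⟨M₁ + M₂, fun R ↦ ?_⟩
    obtain ⟨C₁, Y₁, hY₁⟩ := hM₁ R
    obtain ⟨C₂, Y₂, hY₂⟩ := hM₂ R
    refine ⟨C₁ * C₂, max Y₁ Y₂, fun τ hre him ↦ ?_⟩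
    have e₁ := hY₁ τ hre ((le_max_left _ _).trans him)
    have e₂ := hY₂ τ hre ((le_max_right _ _).trans him)
    calc ‖(g₁ * g₂) τ‖ = ‖g₁ τ‖ * ‖g₂ τ‖ := norm_mul _ _
      _ ≤ (C₁ * τ.im ^ M₁) * (C₂ * τ.im ^ M₂) :=
        mul_le_mul e₁ e₂ (norm_nonneg _) ((norm_nonneg _).trans e₁)
      _ = C₁ * C₂ * τ.im ^ (M₁ + M₂) := by ring
  slash γ := by
    rw [ModularForm.mul_slash_SL2, h₁.slash, h₂.slash]
    ext τ
    simp only [Pi.mul_apply, MonoidHom.mul_apply]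
    ring

/-- A form with trivial character, as a form invariant under the slash action. -/
def IsCharForm.slashInvariantForm {k : ℤ} {g : ℍ → ℂ} (h : IsCharForm 1 k g) :
    SlashInvariantForm 𝒮ℒ k where
  toFun := g
  slash_action_eq' := by
    rintro _ ⟨γ, rfl⟩
    have := h.slash γ
    simp only [MonoidHom.one_apply, one_mul] at this
    exact this

/-- Invariance under `T` moves any point into a strip of bounded real part, so the locally uniform
bound becomes uniform. -/
lemma IsCharForm.exists_bound {k : ℤ} {g : ℍ → ℂ} (h : IsCharForm 1 k g) :
    ∃ (M : ℕ) (C Y : ℝ), ∀ τ : ℍ, Y ≤ τ.im → ‖g τ‖ ≤ C * τ.im ^ M := by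
  obtain ⟨M, hM⟩ := h.growth
  obtain ⟨C, Y, hY⟩ := hM 1
  refine ⟨M, C, Y, fun τ hτ ↦ ?_⟩
  have hp : ((-⌊τ.re⌋ : ℤ) : ℝ) ∈ (𝒮ℒ).strictPeriods := by
    rw [Subgroup.strictPeriods_SL2Z]
    exact AddSubgroup.mem_zmultiples_iff.mpr ⟨-⌊τ.re⌋, by simp⟩
  have h1 : g (((-⌊τ.re⌋ : ℤ) : ℝ) +ᵥ τ) = g τ :=
    SlashInvariantForm.vAdd_apply_of_mem_strictPeriods h.slashInvariantForm τ hp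
  have h2 := hY (((-⌊τ.re⌋ : ℤ) : ℝ) +ᵥ τ) (by
    rw [vadd_re, abs_le]
    push_cast
    constructor <;> linarith [Int.floor_le τ.re, Int.lt_floor_add_one τ.re]) (by simpa using hτ)
  rwa [h1, vadd_im] at h2

/-- Polynomial growth of `g` makes `q * g` vanish at infinity. A periodic holomorphic function
vanishing there is `O(q)`, and dividing by `q` bounds `g`. -/
lemma IsCharForm.isBoundedAtImInfty {k : ℤ} {g : ℍ → ℂ} (h : IsCharForm 1 k g) :
    IsBoundedAtImInfty g := by
  obtain ⟨M, C, Y, hb⟩ := h.exists_bound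
  have hper : Function.Periodic (g ∘ ofComplex) (1 : ℝ) :=
    SlashInvariantFormClass.periodic_comp_ofComplex h.slashInvariantForm one_mem_strictPeriods_SL
  let f : ℍ → ℂ := fun τ ↦ Function.Periodic.qParam 1 τ * g τ
  have hnq (τ : ℍ) : ‖Function.Periodic.qParam 1 (τ : ℂ)‖ = Real.exp (-2 * Real.pi * τ.im) := by
    rw [Function.Periodic.norm_qParam]
    simp
  have hf0 : IsZeroAtImInfty f := by
    have hlim : Filter.Tendsto (fun τ : ℍ ↦ C * (τ.im ^ M * Real.exp (-(2 * Real.pi) * τ.im)))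
        atImInfty (nhds 0) := by
      have h1 := (tendsto_rpow_mul_exp_neg_mul_atTop_nhds_zero M (2 * Real.pi)
        Real.two_pi_pos).const_mul C
      simp only [mul_zero, Real.rpow_natCast] at h1
      exact h1.comp Filter.tendsto_comap
    refine squeeze_zero_norm' ?_ hlim
    filter_upwards [(atImInfty_mem {τ | Y ≤ τ.im}).mpr ⟨Y, fun _ h ↦ h⟩] with τ hτ
    calc ‖f τ‖ = Real.exp (-2 * Real.pi * τ.im) * ‖g τ‖ := by rw [norm_mul, hnq]
      _ ≤ Real.exp (-2 * Real.pi * τ.im) * (C * τ.im ^ M) := by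
        gcongr
        exact hb τ hτ
      _ = C * (τ.im ^ M * Real.exp (-(2 * Real.pi) * τ.im)) := by
        rw [neg_mul]
        ring
  have hfper : Function.Periodic (f ∘ ofComplex) (1 : ℝ) := by
    intro w
    by_cases! hw : 0 < w.im
    · have hw' : 0 < (w + (1 : ℝ)).im := by simpa using hw
      have h1 := hper w
      simp only [Function.comp_apply, ofComplex_apply_of_im_pos hw', ofComplex_apply_of_im_pos hw]
        at h1 ⊢
      simp only [f, h1]
      congr 1
      rw [Function.Periodic.qParam, Function.Periodic.qParam, Complex.exp_eq_exp_iff_exists_int]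
      exact ⟨1, by push_cast; ring⟩
    · have hw' : (w + (1 : ℝ)).im ≤ 0 := by simpa using hw
      simp only [Function.comp_apply, ofComplex_apply_of_im_nonpos hw',
        ofComplex_apply_of_im_nonpos hw]
  have hfholo : MDiff f :=
    (Function.Periodic.differentiable_qParam.mdifferentiable.comp mdifferentiable_coe).mul h.holo
  obtain ⟨K, hK⟩ := (hf0.exp_decay_atImInfty one_pos hfper hfholo hf0.isBoundedAtImInfty).bound
  refine Asymptotics.IsBigO.of_bound K ?_
  filter_upwards [hK] with τ hτ
  rw [norm_mul, hnq, div_one, Real.norm_eq_abs, Real.abs_exp, mul_comm] at hτ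
  simpa using le_of_mul_le_mul_right hτ (Real.exp_pos _)

lemma IsCharForm.mem_qAlg {k : ℤ} {g : ℍ → ℂ} (h : IsCharForm 1 k g) : g ∈ qAlg := by
  have hs (γ : SL(2, ℤ)) : g ∣[k] γ = g := by
    have := h.slash γ
    simpa only [MonoidHom.one_apply, one_mul] using this
  let f : ModularForm 𝒮ℒ k :=
    { h.slashInvariantForm with
      holo' := h.holo
      bdd_at_cusps' {c} hc := by
        rw [Subgroup.IsArithmetic.isCusp_iff_isCusp_SL2Z] at hc
        rw [OnePoint.isBoundedAt_iff_forall_SL2Z hc]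
        intro γ _
        change IsBoundedAtImInfty (g ∣[k] γ)
        rw [hs γ]
        exact h.isBoundedAtImInfty }
  exact modularForm_mem_qAlg k f

/-- The span over `qAlg` of the forms with character `χ` of all weights. -/
noncomputable def charSpan (χ : SL(2, ℤ) →* ℂ) : Submodule ℂ (ℍ → ℂ) :=
  Submodule.span ℂ {f | ∃ c ∈ qAlg, ∃ k g, IsCharForm χ k g ∧ f = c * g}

lemma charSpan_mul {χ₁ χ₂ : SL(2, ℤ) →* ℂ} {f₁ f₂ : ℍ → ℂ} (h₁ : f₁ ∈ charSpan χ₁)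
    (h₂ : f₂ ∈ charSpan χ₂) : f₁ * f₂ ∈ charSpan (χ₁ * χ₂) := by
  have : charSpan χ₁ * charSpan χ₂ ≤ charSpan (χ₁ * χ₂) := by
    rw [charSpan, charSpan, Submodule.span_mul_span, Submodule.span_le]
    rintro _ ⟨_, ⟨c₁, hc₁, k₁, g₁, hg₁, rfl⟩, _, ⟨c₂, hc₂, k₂, g₂, hg₂, rfl⟩, rfl⟩
    exact Submodule.subset_span ⟨c₁ * c₂, qAlg.mul_mem hc₁ hc₂, _, _, hg₁.mul hg₂,
      mul_mul_mul_comm _ _ _ _⟩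
  exact this (Submodule.mul_mem_mul h₁ h₂)

lemma charSpan_pow {χ : SL(2, ℤ) →* ℂ} {f : ℍ → ℂ} (h : f ∈ charSpan χ) (n : ℕ) :
    f ^ (n + 1) ∈ charSpan (χ ^ (n + 1)) := by
  induction n with
  | zero => simpa using h
  | succ n ih =>
    rw [pow_succ, pow_succ χ]
    exact charSpan_mul ih h

lemma charSpan_one_le {f : ℍ → ℂ} (h : f ∈ charSpan 1) : f ∈ qAlg := by
  have : charSpan 1 ≤ Subalgebra.toSubmodule qAlg := by
    rw [charSpan, Submodule.span_le]
    rintro _ ⟨c, hc, k, g, hg, rfl⟩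
    exact qAlg.mul_mem hc hg.mem_qAlg
  exact this h

end VVMF

/-! ### Vector-valued forms over `qAlg`: derivatives, determinants, Cramer's rule. -/

namespace VVMF

open Derivative PowerSeries ModularGroup

variable {d : ℕ}

/-- The span over `qAlg` of the vector-valued modular forms for `ρ` of all weights. -/
noncomputable def vecSpan (ρ : SL(2, ℤ) →* GL (Fin d) ℂ) : Submodule ℂ (ℍ → Fin d → ℂ) :=
  Submodule.span ℂ {x | ∃ c ∈ qAlg, ∃ k, ∃ G ∈ formSpace ρ k, x = fun τ ↦ c τ • G τ}

/-- The componentwise derivative `(2πi)⁻¹ d/dτ`. -/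
noncomputable def vecDeriv (x : ℍ → Fin d → ℂ) : ℍ → Fin d → ℂ :=
  fun τ i ↦ normalizedDerivOfComplex (fun z ↦ x z i) τ

lemma vecDeriv_add {x y : ℍ → Fin d → ℂ} (hx : ∀ i, MDiff (fun τ ↦ x τ i))
    (hy : ∀ i, MDiff (fun τ ↦ y τ i)) : vecDeriv (x + y) = vecDeriv x + vecDeriv y := by
  ext τ i
  exact congrFun (normalizedDerivOfComplex_add _ _ (hx i) (hy i)) τ

lemma vecDeriv_const_smul (c : ℂ) {x : ℍ → Fin d → ℂ} (hx : ∀ i, MDiff (fun τ ↦ x τ i)) :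
    vecDeriv (c • x) = c • vecDeriv x := by
  ext τ i
  exact congrFun (normalizedDerivOfComplex_smul c _ (hx i)) τ

lemma vecDeriv_zero : vecDeriv (0 : ℍ → Fin d → ℂ) = 0 := by
  ext τ i
  exact congrFun (normalizedDerivOfComplex_const 0) τ

lemma vecDeriv_smul {c : ℍ → ℂ} {x : ℍ → Fin d → ℂ} (hc : MDiff c)
    (hx : ∀ i, MDiff (fun τ ↦ x τ i)) :
    vecDeriv (fun τ ↦ c τ • x τ) =
      (fun τ ↦ normalizedDerivOfComplex c τ • x τ) + fun τ ↦ c τ • vecDeriv x τ := by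
  ext τ i
  exact congrFun (normalizedDerivOfComplex_mul _ _ hc (hx i)) τ

variable {ρ : SL(2, ℤ) →* GL (Fin d) ℂ}

lemma formSpace_le_vecSpan (k : ℤ) : formSpace ρ k ≤ vecSpan ρ := fun G hG ↦
  Submodule.subset_span ⟨1, qAlg.one_mem, k, G, hG, by ext; simp⟩

lemma formModule_le_vecSpan : formModule ρ ≤ vecSpan ρ := iSup_le formSpace_le_vecSpan

lemma vecSpan_mdifferentiable {x : ℍ → Fin d → ℂ} (hx : x ∈ vecSpan ρ) (i : Fin d) :
    MDiff (fun τ ↦ x τ i) := by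
  induction hx using Submodule.span_induction with
  | mem x hx =>
    obtain ⟨c, hc, k, G, hG, rfl⟩ := hx
    exact hc.1.mul (hG.holo i)
  | zero => exact mdifferentiable_const
  | add x y _ _ hx hy => exact hx.add hy
  | smul c x _ hx => exact hx.const_smul c

lemma vecSpan_smul_mem {c : ℍ → ℂ} (hc : c ∈ qAlg) {x : ℍ → Fin d → ℂ} (hx : x ∈ vecSpan ρ) :
    (fun τ ↦ c τ • x τ) ∈ vecSpan ρ := by
  induction hx using Submodule.span_induction with
  | mem x hx =>
    obtain ⟨c', hc', k, G, hG, rfl⟩ := hx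
    exact Submodule.subset_span ⟨c * c', qAlg.mul_mem hc hc', k, G, hG, by ext; simp [mul_assoc]⟩
  | zero =>
    convert! (vecSpan ρ).zero_mem using 1
    ext
    simp
  | add x y _ _ hx hy =>
    convert! (vecSpan ρ).add_mem hx hy using 1
    ext
    simp [mul_add]
  | smul a x _ hx =>
    convert! (vecSpan ρ).smul_mem a hx using 1
    ext
    simp [mul_left_comm]

section Cyclic

variable {k₀ : ℤ} {F₀ : ℍ → Fin d → ℂ}

/-- Cyclicity puts `D ^ j F₀` in `formModule ρ` directly, as its multiple by the constant form `1`;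
modularity and growth of derivatives need not be proved. -/
lemma modularDeriv_mem_vecSpan (hcyc : formModule ρ = cyclicModule k₀ F₀) (j : ℕ) :
    modularDeriv k₀ j F₀ ∈ vecSpan ρ := by
  refine formModule_le_vecSpan ?_
  rw [hcyc]
  exact Submodule.subset_span ⟨j, 0, 1, by ext; simp⟩

/-- The plain derivative is the modular one plus a multiple of `E₂`, which is why `qAlg` has to
contain `E₂`. -/
lemma vecDeriv_modularDeriv_mem_vecSpan (hcyc : formModule ρ = cyclicModule k₀ F₀) (j : ℕ) :
    vecDeriv (modularDeriv k₀ j F₀) ∈ vecSpan ρ := by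
  have h : vecDeriv (modularDeriv k₀ j F₀) = modularDeriv k₀ (j + 1) F₀ +
      fun τ ↦ ((((k₀ : ℂ) + 2 * (j : ℂ)) * 12⁻¹) • EisensteinSeries.E2) τ •
        modularDeriv k₀ j F₀ τ := by
    ext τ i
    simp [vecDeriv, modularDeriv]
  rw [h]
  exact (vecSpan ρ).add_mem (modularDeriv_mem_vecSpan hcyc _)
    (vecSpan_smul_mem (qAlg.smul_mem E2_mem_qAlg _) (modularDeriv_mem_vecSpan hcyc _))

lemma vecDeriv_formModule_mem_vecSpan (hcyc : formModule ρ = cyclicModule k₀ F₀)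
    {G : ℍ → Fin d → ℂ} (hG : G ∈ formModule ρ) :
    vecDeriv G ∈ vecSpan ρ := by
  have hle : cyclicModule k₀ F₀ ≤ vecSpan ρ := hcyc ▸ formModule_le_vecSpan
  rw [hcyc] at hG
  induction hG using Submodule.span_induction with
  | mem x hx =>
    obtain ⟨j, w, g, rfl⟩ := hx
    have hg := modularForm_mem_qAlg w g
    have hF := modularDeriv_mem_vecSpan hcyc j
    rw [vecDeriv_smul hg.1 (vecSpan_mdifferentiable hF)]
    exact (vecSpan ρ).add_mem (vecSpan_smul_mem (qAlg_normalizedDeriv hg) hF)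
      (vecSpan_smul_mem hg (vecDeriv_modularDeriv_mem_vecSpan hcyc j))
  | zero =>
    rw [vecDeriv_zero]
    exact (vecSpan ρ).zero_mem
  | add x y hx hy hx' hy' =>
    rw [vecDeriv_add (vecSpan_mdifferentiable (hle hx)) (vecSpan_mdifferentiable (hle hy))]
    exact (vecSpan ρ).add_mem hx' hy'
  | smul c x hx hx' =>
    rw [vecDeriv_const_smul c (vecSpan_mdifferentiable (hle hx))]
    exact (vecSpan ρ).smul_mem c hx'

lemma vecDeriv_mem_vecSpan (hcyc : formModule ρ = cyclicModule k₀ F₀)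
    {x : ℍ → Fin d → ℂ} (hx : x ∈ vecSpan ρ) : vecDeriv x ∈ vecSpan ρ := by
  induction hx using Submodule.span_induction with
  | mem x hx =>
    obtain ⟨c, hc, k, G, hG, rfl⟩ := hx
    rw [vecDeriv_smul hc.1 hG.holo]
    exact (vecSpan ρ).add_mem
      (vecSpan_smul_mem (qAlg_normalizedDeriv hc) (formSpace_le_vecSpan k hG))
      (vecSpan_smul_mem hc (vecDeriv_formModule_mem_vecSpan hcyc
        (Submodule.mem_iSup_of_mem k hG)))
  | zero =>
    rw [vecDeriv_zero]
    exact (vecSpan ρ).zero_mem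
  | add x y hx hy hx' hy' =>
    rw [vecDeriv_add (vecSpan_mdifferentiable hx) (vecSpan_mdifferentiable hy)]
    exact (vecSpan ρ).add_mem hx' hy'
  | smul c x hx hx' =>
    rw [vecDeriv_const_smul c (vecSpan_mdifferentiable hx)]
    exact (vecSpan ρ).smul_mem c hx'

lemma iterate_vecDeriv_mem_vecSpan (hcyc : formModule ρ = cyclicModule k₀ F₀)
    {x : ℍ → Fin d → ℂ} (hx : x ∈ vecSpan ρ) (j : ℕ) :
    vecDeriv^[j] x ∈ vecSpan ρ := by
  induction j with
  | zero => exact hx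
  | succ j ih =>
    rw [Function.iterate_succ_apply']
    exact vecDeriv_mem_vecSpan hcyc ih

end Cyclic

variable (ρ) in
/-- The determinant character of a matrix representation. -/
noncomputable def detChar : SL(2, ℤ) →* ℂ :=
  Matrix.detMonoidHom.comp ((Units.coeHom (Matrix (Fin d) (Fin d) ℂ)).comp ρ)

lemma IsVVMF.apply_smul {k : ℤ} {G : ℍ → Fin d → ℂ} (hG : IsVVMF ρ k G) (γ : SL(2, ℤ)) (τ : ℍ) :
    G (γ • τ) = denom γ τ ^ k • (ρ γ : Matrix (Fin d) (Fin d) ℂ).mulVec (G τ) := by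
  ext i
  have := congrFun (hG.slash γ i) τ
  rw [ModularForm.SL_slash_apply] at this
  rw [Pi.smul_apply, smul_eq_mul, ← this, zpow_neg, mul_comm, mul_assoc,
    inv_mul_cancel₀ (zpow_ne_zero _ (denom_ne_zero _ _)), mul_one]

/-- The rows transform by `ρ γ` and a power of the automorphy factor, so the determinant picks up
`det (ρ γ)` and the sum of the weights. -/
lemma isCharForm_det {k : Fin d → ℤ} {G : Fin d → ℍ → Fin d → ℂ}
    (hG : ∀ t, IsVVMF ρ (k t) (G t)) :
    IsCharForm (detChar ρ) (∑ t, k t) (fun τ ↦ Matrix.det (Matrix.of fun t ↦ G t τ)) where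
  holo := by
    rw [UpperHalfPlane.mdifferentiable_iff]
    have h (t i) := UpperHalfPlane.mdifferentiable_iff.mp ((hG t).holo i)
    simp only [Function.comp_def, Matrix.det_apply, Matrix.of_apply]
    exact DifferentiableOn.fun_sum fun σ _ ↦
      (DifferentiableOn.fun_finsetProd fun t _ ↦ h _ _).const_smul _
  growth := by
    choose M hM using fun t ↦ (hG t).growth
    refine ⟨(∑ t, M t) * d, fun R ↦ ?_⟩
    choose Y hY using fun t i ↦ hM t i R
    obtain ⟨B, hB⟩ := (Set.finite_range (fun q : Fin d × Fin d ↦ Y q.1 q.2)).bddAbove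
    refine ⟨d.factorial, max 1 B, fun τ hre him ↦ ?_⟩
    have h1 : 1 ≤ τ.im := (le_max_left _ _).trans him
    have := Matrix.det_le (A := Matrix.of fun t ↦ G t τ) (abv := NormedField.toAbsoluteValue ℂ)
      (x := τ.im ^ (∑ t, M t)) fun t i ↦ by
        refine (hY t i τ hre (?_ : Y t i ≤ τ.im)).le.trans (pow_le_pow_right₀ h1 ?_)
        · exact (hB ⟨(t, i), rfl⟩).trans ((le_max_right _ _).trans him)
        · exact Finset.single_le_sum (fun _ _ ↦ Nat.zero_le _) (Finset.mem_univ t)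
    rw [Fintype.card_fin, nsmul_eq_mul, ← pow_mul] at this
    exact this
  slash γ := by
    ext τ
    rw [ModularForm.SL_slash_apply]
    have hmat : (Matrix.of fun t ↦ G t (γ • τ)) = Matrix.diagonal (fun t ↦ denom γ τ ^ (k t)) *
        ((Matrix.of fun t ↦ G t τ) * (ρ γ : Matrix (Fin d) (Fin d) ℂ).transpose) := by
      ext t i
      rw [Matrix.diagonal_mul, Matrix.of_apply, (hG t).apply_smul, Matrix.mul_apply]
      simp [Matrix.mulVec, dotProduct, mul_comm]
    rw [hmat, Matrix.det_mul, Matrix.det_diagonal, Matrix.det_mul, Matrix.det_transpose,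
      zpow_neg]
    have hne := denom_ne_zero γ τ
    have hprod : ∏ t, denom γ τ ^ (k t) = denom γ τ ^ (∑ t, k t) := by
      induction (Finset.univ : Finset (Fin d)) using Finset.induction_on with
      | empty => simp
      | insert t s ht ih => rw [Finset.prod_insert ht, Finset.sum_insert ht, zpow_add₀ hne, ih]
    rw [hprod]
    have hne' := zpow_ne_zero (∑ t, k t) hne
    simp only [detChar, MonoidHom.comp_apply, Matrix.coe_detMonoidHom, Units.coeHom_apply]
    field_simp

/-- Multilinearity in the rows reduces to determinants of genuine forms. -/
lemma det_mem_charSpan {x : Fin d → ℍ → Fin d → ℂ} (hx : ∀ t, x t ∈ vecSpan ρ) :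
    (fun τ ↦ Matrix.det (Matrix.of fun t ↦ x t τ)) ∈ charSpan (detChar ρ) := by
  choose n a y hxy using fun t ↦ Submodule.mem_span_set'.mp (hx t)
  choose c hc k G hG hy using fun t i ↦ (y t i).2
  have hexp : (fun τ ↦ Matrix.det (Matrix.of fun t ↦ x t τ)) =
      ∑ r : (t : Fin d) → Fin (n t), (∏ t, a t (r t)) • ((∏ t, c t (r t)) *
        fun τ ↦ Matrix.det (Matrix.of fun t ↦ G t (r t) τ)) := by
    ext τ
    have h1 (t : Fin d) : x t τ = ∑ i, (a t i * c t i τ) • G t i τ := by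
      rw [← hxy t, Finset.sum_apply]
      refine Finset.sum_congr rfl fun i _ ↦ ?_
      rw [Pi.smul_apply, hy t i, smul_smul]
    have h2 := (Matrix.detRowAlternating (n := Fin d) (R := ℂ)).toMultilinearMap.map_sum
      (fun t i ↦ (a t i * c t i τ) • G t i τ)
    simp only [MultilinearMap.map_smul_univ] at h2
    rw [Finset.sum_apply]
    refine (congrArg Matrix.det (congrArg Matrix.of (funext h1))).trans (h2.trans ?_)
    refine Finset.sum_congr rfl fun r _ ↦ ?_
    simp only [Pi.smul_apply, Pi.mul_apply, Finset.prod_apply, Finset.prod_mul_distrib,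
      smul_eq_mul, mul_assoc]
    rfl
  rw [hexp]
  refine Submodule.sum_mem _ fun r _ ↦ Submodule.smul_mem _ _ (Submodule.subset_span ?_)
  exact ⟨_, qAlg.prod_mem fun t _ ↦ hc t (r t), _, _, isCharForm_det fun t ↦ hG t (r t), rfl⟩

/-- Cramer's rule: if `X₁, …, X_d` are generically independent elements of `vecSpan ρ`, then
every element of `vecSpan ρ` has a nonzero multiple in their span over `qAlg`. -/
lemma exists_relation {X : Fin d → ℍ → Fin d → ℂ} (hX : ∀ t, X t ∈ vecSpan ρ)
    {y : ℍ → Fin d → ℂ} (hy : y ∈ vecSpan ρ) {τ₀ : ℍ}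
    (hτ₀ : Matrix.det (Matrix.of fun t ↦ X t τ₀) ≠ 0) :
    ∃ Q ∈ qAlg, Q ≠ 0 ∧ ∃ R : Fin d → ℍ → ℂ, (∀ t, R t ∈ qAlg) ∧
      ∀ τ i, Q τ * y τ i = ∑ t, R t τ * X t τ i := by
  set W : ℍ → ℂ := fun τ ↦ Matrix.det (Matrix.of fun t ↦ X t τ) with hW
  have hWmem : W ∈ charSpan (detChar ρ) := det_mem_charSpan hX
  let V : Fin d → ℍ → ℂ := fun t τ ↦ Matrix.det (Matrix.of fun s ↦ Function.update X t y s τ)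
  have hV (t : Fin d) : V t ∈ charSpan (detChar ρ) := det_mem_charSpan fun s ↦ by
    rcases eq_or_ne s t with rfl | hs
    · simpa using hy
    · simpa [hs] using hX s
  -- Cramer gives `W * y = ∑ V t * X t`. The factor `W ^ 11` turns the character `det ρ` of each
  -- coefficient into its trivial twelfth power.
  refine ⟨W ^ 12, ?_, fun h ↦ ?_, fun t ↦ W ^ 11 * V t, fun t ↦ ?_, fun τ i ↦ ?_⟩
  · have := charSpan_pow hWmem 11
    rw [character_pow_twelve] at this
    exact charSpan_one_le this
  · exact hτ₀ (pow_eq_zero_iff (n := 12) (by norm_num) |>.mp (congrFun h τ₀))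
  · have := charSpan_mul (charSpan_pow hWmem 10) (hV t)
    rw [← pow_succ, character_pow_twelve] at this
    exact charSpan_one_le this
  · have hcr := congrFun (Matrix.mulVec_cramer (Matrix.of fun t ↦ X t τ).transpose (y τ)) i
    have hVτ (t : Fin d) : V t τ = Matrix.cramer (Matrix.of fun t ↦ X t τ).transpose (y τ) t := by
      rw [Matrix.cramer_transpose_apply]
      refine congrArg Matrix.det (Matrix.ext fun s j ↦ ?_)
      rcases eq_or_ne s t with rfl | hs <;> simp [*]
    simp only [Matrix.mulVec, dotProduct, Matrix.transpose_apply, Matrix.of_apply, ← hVτ,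
      Matrix.det_transpose, Pi.smul_apply, smul_eq_mul] at hcr
    simp only [Pi.mul_apply, Pi.pow_apply]
    calc W τ ^ 12 * y τ i = W τ ^ 11 * (W τ * y τ i) := by ring
      _ = W τ ^ 11 * ∑ t, X t τ i * V t τ := by rw [hcr]
      _ = _ := by
        rw [Finset.mul_sum]
        exact Finset.sum_congr rfl fun t _ ↦ by ring

end VVMF

/-! ### Independence of the components and of the derivatives of a form. -/

namespace VVMF

open Derivative PowerSeries ModularGroup

variable {d : ℕ} {ρ : SL(2, ℤ) →* GL (Fin d) ℂ}

/-- The vectors whose whole orbit lies in the kernel of `l` form a subrepresentation containing all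
values of `G`. By irreducibility it is zero, and then `G = 0`, or everything, and then `l = 0`. -/
lemma eq_zero_of_dotProduct_eq_zero (hirr : (toRepresentation ρ).IsIrreducible) {k : ℤ}
    {G : ℍ → Fin d → ℂ} (hG : IsVVMF ρ k G) {l : Fin d → ℂ} (hl : l ≠ 0)
    (h : ∀ τ, l ⬝ᵥ G τ = 0) : G = 0 := by
  let W : Subrepresentation (toRepresentation ρ) :=
    { toSubmodule :=
        { carrier := {v | ∀ γ, l ⬝ᵥ (ρ γ : Matrix (Fin d) (Fin d) ℂ).mulVec v = 0}
          zero_mem' := fun γ ↦ by simp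
          add_mem' := fun hv hw γ ↦ by rw [Matrix.mulVec_add, dotProduct_add, hv γ, hw γ, add_zero]
          smul_mem' := fun c v hv γ ↦ by
            rw [Matrix.mulVec_smul, dotProduct_smul, hv γ, smul_zero] }
      apply_mem_toSubmodule := fun g v hv γ ↦ by
        have := hv (γ * g)
        rwa [map_mul, Units.val_mul, ← Matrix.mulVec_mulVec] at this }
  have hmem (τ : ℍ) : G τ ∈ W.toSubmodule := fun γ ↦ by
    have := h (γ • τ)
    rw [hG.apply_smul, dotProduct_smul, smul_eq_mul] at this
    exact (mul_eq_zero.mp this).resolve_left (zpow_ne_zero _ (denom_ne_zero _ _))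
  rcases hirr.eq_bot_or_eq_top W with hW | hW
  · ext τ i
    have := hmem τ
    rw [hW] at this
    exact congrFun ((Submodule.mem_bot ℂ).mp this) i
  · refine absurd (dotProduct_eq_zero l fun v ↦ ?_) hl
    have hv : v ∈ W.toSubmodule := by
      rw [hW]
      exact Submodule.mem_top
    simpa using hv 1

/-- Separates the weights. `T ^ N` acts trivially, so at `S • w` with `w = τ + N n` the relation
reads `∑ w ^ k * v k = 0`, with `v` independent of `n`. A Laurent polynomial with infinitely many
zeros vanishes. -/
lemma dotProduct_homogeneous_eq_zero {N : ℕ} (hN : 0 < N) (hT : ρ T ^ N = 1)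
    {s : Finset ℤ} {G : ℤ → ℍ → Fin d → ℂ} (hG : ∀ k, IsVVMF ρ k (G k)) {l : Fin d → ℂ}
    (h : ∀ τ, l ⬝ᵥ ∑ k ∈ s, G k τ = 0) {k : ℤ} (hk : k ∈ s) (τ : ℍ) : l ⬝ᵥ G k τ = 0 := by
  suffices hS : ∀ τ, l ⬝ᵥ (ρ S : Matrix (Fin d) (Fin d) ℂ).mulVec (G k τ) = 0 by
    have h1 := (hG k).apply_smul S (S⁻¹ • τ)
    rw [smul_inv_smul] at h1
    rw [h1, dotProduct_smul, hS, smul_zero]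
  intro τ
  set v : ℤ → ℂ := fun k ↦ l ⬝ᵥ (ρ S : Matrix (Fin d) (Fin d) ℂ).mulVec (G k τ) with hv
  -- Weights may be negative; multiplying by `w ^ K` gives a polynomial.
  obtain ⟨K, hK⟩ : ∃ K : ℕ, ∀ k ∈ s, 0 ≤ k + K := by
    refine ⟨∑ k ∈ s, k.natAbs, fun k hk ↦ ?_⟩
    have := Finset.single_le_sum (f := Int.natAbs) (fun _ _ ↦ Nat.zero_le _) hk
    lia
  let P : Polynomial ℂ := ∑ k ∈ s, Polynomial.monomial (k + K).toNat (v k)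
  have hroot (n : ℕ) : P.eval ((τ : ℂ) + ((N * n : ℕ) : ℂ)) = 0 := by
    set w : ℍ := T ^ ((N * n : ℕ) : ℤ) • τ with hw
    have hwc : (w : ℂ) = (τ : ℂ) + ((N * n : ℕ) : ℂ) := by
      rw [hw, coe_T_zpow_smul_eq]
      push_cast
      rfl
    have hw0 : (w : ℂ) ≠ 0 := w.ne_zero
    have hGw (k : ℤ) : G k w = G k τ := by
      have h1 := (hG k).apply_smul (T ^ ((N * n : ℕ) : ℤ)) τ
      have h2 : ρ (T ^ ((N * n : ℕ) : ℤ)) = 1 := by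
        rw [zpow_natCast, map_pow, pow_mul, hT, one_pow]
      have h3 : denom (T ^ ((N * n : ℕ) : ℤ) : SL(2, ℤ)) τ = 1 := by
        rw [denom_apply, coe_T_zpow]
        simp
      rw [← hw, h2, h3] at h1
      simpa using h1
    have h1 := h (S • w)
    have h2 (k : ℤ) : l ⬝ᵥ G k (S • w) = (w : ℂ) ^ k * v k := by
      rw [(hG k).apply_smul, hGw, dotProduct_smul, smul_eq_mul, denom_S]
    simp only [dotProduct_sum, h2] at h1
    rw [← hwc, Polynomial.eval_finsetSum]
    calc ∑ k ∈ s, Polynomial.eval (w : ℂ) (Polynomial.monomial (k + K).toNat (v k))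
        = ∑ k ∈ s, (w : ℂ) ^ K * ((w : ℂ) ^ k * v k) := by
          refine Finset.sum_congr rfl fun k hk ↦ ?_
          rw [Polynomial.eval_monomial, ← zpow_natCast, Int.toNat_of_nonneg (hK k hk),
            zpow_add₀ hw0, zpow_natCast]
          ring
      _ = 0 := by rw [← Finset.mul_sum, h1, mul_zero]
  have hP : P = 0 := by
    refine Polynomial.eq_zero_of_infinite_isRoot P ?_
    refine Set.infinite_of_injective_forall_mem
      (f := fun n : ℕ ↦ (τ : ℂ) + ((N * n : ℕ) : ℂ)) (fun a b hab ↦ ?_) hroot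
    exact Nat.eq_of_mul_eq_mul_left hN (by exact_mod_cast add_left_cancel hab)
  have hcoeff : P.coeff (k + K).toNat = v k := by
    simp only [P, Polynomial.finsetSum_coeff, Polynomial.coeff_monomial]
    rw [Finset.sum_eq_single_of_mem k hk, if_pos rfl]
    intro m hm hmk
    refine if_neg fun hmk' ↦ hmk ?_
    have := hK k hk
    have := hK m hm
    lia
  rw [hP] at hcoeff
  simpa using hcoeff.symm

lemma linearForm_eq_zero (hirr : (toRepresentation ρ).IsIrreducible) {N : ℕ} (hN : 0 < N)
    (hT : ρ T ^ N = 1) {F : ℍ → Fin d → ℂ} (hF : F ∈ formModule ρ) (hF0 : F ≠ 0)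
    {l : Fin d → ℂ} (h : ∀ τ, l ⬝ᵥ F τ = 0) : l = 0 := by
  obtain ⟨G, hG, rfl⟩ := (Submodule.mem_iSup_iff_exists_finsupp _ _).mp hF
  by_contra hl
  refine hF0 (Finset.sum_eq_zero fun k hk ↦ ?_)
  refine eq_zero_of_dotProduct_eq_zero hirr (hG k) hl fun τ ↦ ?_
  refine dotProduct_homogeneous_eq_zero hN hT hG (fun τ ↦ ?_) hk τ
  have := h τ
  rwa [Finsupp.sum, Finset.sum_apply] at this

lemma iterate_normalizedDeriv_apply (g : ℍ → ℂ) (j : ℕ) (τ : ℍ) :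
    normalizedDerivOfComplex^[j] g τ =
      ((2 * Real.pi * Complex.I)⁻¹) ^ j * iteratedDeriv j (g ∘ ofComplex) τ := by
  induction j generalizing τ with
  | zero => simp
  | succ j ih =>
    rw [Function.iterate_succ_apply', normalizedDerivOfComplex, iteratedDeriv_succ, pow_succ',
      mul_assoc (2 * Real.pi * Complex.I)⁻¹, ← deriv_const_mul_field (((2 * Real.pi * Complex.I)⁻¹) ^ j)]
    congr 1
    refine Filter.EventuallyEq.deriv_eq ?_
    filter_upwards [isOpen_upperHalfPlaneSet.mem_nhds τ.im_pos] with z hz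
    rw [Function.comp_apply, ofComplex_apply_of_im_pos hz, ih]

lemma eq_zero_of_iterate_normalizedDeriv {g : ℍ → ℂ} (hg : MDiff g) {τ₀ : ℍ}
    (h : ∀ j, normalizedDerivOfComplex^[j] g τ₀ = 0) : g = 0 := by
  have hd := UpperHalfPlane.mdifferentiable_iff.mp hg
  have hder (j : ℕ) : iteratedDeriv j (g ∘ ofComplex) τ₀ = 0 := by
    have := h j
    rw [iterate_normalizedDeriv_apply] at this
    exact (mul_eq_zero.mp this).resolve_left
      (pow_ne_zero _ (inv_ne_zero Complex.two_pi_I_ne_zero))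
  obtain ⟨r, hr, hball⟩ := Metric.isOpen_iff.mp isOpen_upperHalfPlaneSet τ₀ τ₀.im_pos
  have hev : g ∘ ofComplex =ᶠ[nhds (τ₀ : ℂ)] 0 := by
    filter_upwards [Metric.ball_mem_nhds (τ₀ : ℂ) hr] with z hz
    rw [← Complex.taylorSeries_eq_on_ball' hz (hd.mono hball)]
    simp [hder]
  have := (hd.analyticOnNhd isOpen_upperHalfPlaneSet).eqOn_zero_of_preconnected_of_eventuallyEq_zero
    (convex_halfSpace_im_gt 0).isPreconnected τ₀.im_pos hev
  ext τ
  simpa using this τ.im_pos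

lemma vecDeriv_mdifferentiable {x : ℍ → Fin d → ℂ} (hx : ∀ i, MDiff (fun τ ↦ x τ i)) (i : Fin d) :
    MDiff (fun τ ↦ vecDeriv x τ i) :=
  normalizedDerivOfComplex_mdifferentiable (hx i)

lemma iterate_vecDeriv_mdifferentiable {x : ℍ → Fin d → ℂ} (hx : ∀ i, MDiff (fun τ ↦ x τ i))
    (j : ℕ) (i : Fin d) : MDiff (fun τ ↦ vecDeriv^[j] x τ i) := by
  induction j generalizing i with
  | zero => exact hx i
  | succ j ih =>
    rw [Function.iterate_succ_apply']
    exact vecDeriv_mdifferentiable ih i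

lemma normalizedDeriv_dotProduct (l : Fin d → ℂ) {x : ℍ → Fin d → ℂ}
    (hx : ∀ i, MDiff (fun τ ↦ x τ i)) :
    normalizedDerivOfComplex (fun τ ↦ l ⬝ᵥ x τ) = fun τ ↦ l ⬝ᵥ vecDeriv x τ := by
  ext τ
  have hd (i : Fin d) := UpperHalfPlane.mdifferentiableAt_iff.mp (hx i τ)
  have h := deriv_fun_sum (u := Finset.univ) fun i _ ↦ (hd i).const_mul (l i)
  simp only [deriv_const_mul_field] at h
  simp only [normalizedDerivOfComplex, dotProduct, vecDeriv]
  refine (congrArg _ h).trans ?_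
  rw [Finset.mul_sum]
  exact Finset.sum_congr rfl fun i _ ↦ mul_left_comm _ _ _

lemma iterate_normalizedDeriv_dotProduct (l : Fin d → ℂ) {x : ℍ → Fin d → ℂ}
    (hx : ∀ i, MDiff (fun τ ↦ x τ i)) (j : ℕ) :
    normalizedDerivOfComplex^[j] (fun τ ↦ l ⬝ᵥ x τ) = fun τ ↦ l ⬝ᵥ vecDeriv^[j] x τ := by
  induction j with
  | zero => rfl
  | succ j ih =>
    rw [Function.iterate_succ_apply', ih,
      normalizedDeriv_dotProduct l (iterate_vecDeriv_mdifferentiable hx j),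
      Function.iterate_succ_apply']

lemma mdifferentiable_dotProduct (l : Fin d → ℂ) {x : ℍ → Fin d → ℂ}
    (hx : ∀ i, MDiff (fun τ ↦ x τ i)) : MDiff (fun τ ↦ l ⬝ᵥ x τ) := by
  rw [UpperHalfPlane.mdifferentiable_iff]
  exact DifferentiableOn.fun_sum (u := Finset.univ) fun i _ ↦
    (UpperHalfPlane.mdifferentiable_iff.mp (hx i)).const_mul (l i)

lemma exists_det_ne_zero_of_span_eq_top {v : ℕ → Fin d → ℂ}
    (hv : Submodule.span ℂ (Set.range v) = ⊤) :
    ∃ r : Fin d → ℕ, Matrix.det (Matrix.of fun t ↦ v (r t)) ≠ 0 := by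
  obtain ⟨f, hf, -, hli⟩ := Submodule.exists_fun_fin_finrank_span_eq ℂ (Set.range v)
  have hd : Module.finrank ℂ (Submodule.span ℂ (Set.range v)) = d := by
    rw [hv, finrank_top, Module.finrank_fin_fun]
  choose r hr using hf
  refine ⟨r ∘ Fin.cast hd.symm, ?_⟩
  have hli' := hli.comp (Fin.cast hd.symm) (Fin.cast_injective _)
  have hu : IsUnit (Matrix.of fun t ↦ v ((r ∘ Fin.cast hd.symm) t)) := by
    rw [← Matrix.linearIndependent_rows_iff_isUnit]
    convert! hli' using 1
    ext t : 1
    exact hr _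
  exact ((Matrix.isUnit_iff_isUnit_det _).mp hu).ne_zero

/-- A nonzero form has `d` derivatives that are independent at a given point. -/
lemma exists_det_iterate_vecDeriv_ne_zero (hirr : (toRepresentation ρ).IsIrreducible) {N : ℕ}
    (hN : 0 < N) (hT : ρ T ^ N = 1) {F : ℍ → Fin d → ℂ} (hF : F ∈ formModule ρ) (hF0 : F ≠ 0)
    (τ₀ : ℍ) : ∃ r : Fin d → ℕ, Matrix.det (Matrix.of fun t ↦ vecDeriv^[r t] F τ₀) ≠ 0 := by
  refine exists_det_ne_zero_of_span_eq_top (v := fun j ↦ vecDeriv^[j] F τ₀) ?_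
  by_contra hne
  -- A functional killing every derivative at `τ₀` kills the Taylor expansion of `l ⬝ᵥ F` there,
  -- hence `l ⬝ᵥ F` itself, against the independence of the components.
  obtain ⟨f, hf0, hf⟩ := Submodule.exists_le_ker_of_lt_top _ (lt_top_iff_ne_top.mpr hne)
  have hx := fun i ↦ vecSpan_mdifferentiable (formModule_le_vecSpan hF) i
  let l : Fin d → ℂ := fun i ↦ f (Pi.single i 1)
  have hfl (v : Fin d → ℂ) : f v = l ⬝ᵥ v := by
    rw [LinearMap.pi_apply_eq_sum_univ f v]
    refine Finset.sum_congr rfl fun i _ ↦ ?_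
    rw [smul_eq_mul, mul_comm]
    congr 2
    ext j
    simp [Pi.single_apply, eq_comm]
  have hz := eq_zero_of_iterate_normalizedDeriv (τ₀ := τ₀) (mdifferentiable_dotProduct l hx)
    fun j ↦ by
      rw [iterate_normalizedDeriv_dotProduct l hx]
      refine (hfl _).symm.trans ?_
      exact hf (Submodule.subset_span ⟨j, rfl⟩)
  have hl := linearForm_eq_zero hirr hN hT hF hF0 (congrFun hz)
  refine hf0 (LinearMap.ext fun v ↦ ?_)
  rw [hfl, hl, zero_dotProduct, LinearMap.zero_apply]

end VVMF

/-! ### `p`-adic boundedness and growth of coefficients. -/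

namespace VVMF

open PowerSeries

/-- The coefficients of `P` have bounded `p`-adic absolute value. -/
def PBounded (p : ℕ) (P : ℚ⟦X⟧) : Prop :=
  ∃ C : ℚ, ∀ n, padicNorm p (P.coeff n) ≤ C

lemma pBounded_zero {p : ℕ} : PBounded p 0 := ⟨0, fun n ↦ by simp⟩

section Padic

variable {p : ℕ} [hp : Fact p.Prime]

lemma PBounded.add {P Q : ℚ⟦X⟧} (hP : PBounded p P) (hQ : PBounded p Q) : PBounded p (P + Q) := by
  obtain ⟨C, hC⟩ := hP
  obtain ⟨B, hB⟩ := hQ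
  refine ⟨max C B, fun n ↦ ?_⟩
  rw [map_add]
  exact padicNorm.nonarchimedean.trans (max_le_max (hC n) (hB n))

lemma PBounded.mul {P Q : ℚ⟦X⟧} (hP : PBounded p P) (hQ : PBounded p Q) : PBounded p (P * Q) := by
  obtain ⟨C, hC⟩ := hP
  obtain ⟨B, hB⟩ := hQ
  have hC0 := (padicNorm.nonneg _).trans (hC 0)
  have hB0 := (padicNorm.nonneg _).trans (hB 0)
  refine ⟨C * B, fun n ↦ ?_⟩
  rw [coeff_mul]
  refine padicNorm.sum_le' (fun q _ ↦ ?_) (mul_nonneg hC0 hB0)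
  rw [padicNorm.mul]
  exact mul_le_mul (hC _) (hB _) (padicNorm.nonneg _) hC0

lemma PBounded.sum {ι : Type*} {s : Finset ι} {P : ι → ℚ⟦X⟧} (h : ∀ t ∈ s, PBounded p (P t)) :
    PBounded p (∑ t ∈ s, P t) :=
  Finset.sum_induction _ (PBounded p) (fun _ _ ↦ PBounded.add) pBounded_zero h

lemma PBounded.euler {b : ℕ → ℚ} (hb : PBounded p (PowerSeries.mk b)) (r : ℚ) (j : ℕ) :
    PBounded p (PowerSeries.mk fun n ↦ (r + n) ^ j * b n) := by
  obtain ⟨C, hC⟩ := hb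
  refine ⟨max (padicNorm p r) 1 ^ j * C, fun n ↦ ?_⟩
  have hn : padicNorm p (n : ℚ) ≤ 1 := by exact_mod_cast padicNorm.of_nat n
  have h1 : padicNorm p (r + n) ≤ max (padicNorm p r) 1 :=
    padicNorm.nonarchimedean.trans (max_le_max_left _ hn)
  have h2 : padicNorm p ((r + n) ^ j) = padicNorm p (r + n) ^ j :=
    IsAbsoluteValue.abv_pow (padicNorm p) _ _
  have h3 := hC n
  rw [coeff_mk] at h3
  rw [coeff_mk, padicNorm.mul, h2]
  gcongr
  · exact padicNorm.nonneg _
  · exact padicNorm.nonneg _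

lemma pBounded_of_not_dvd_den {b : ℕ → ℚ} {m : ℕ} (h : ∀ n, ¬ p ^ m ∣ (b n).den) :
    PBounded p (PowerSeries.mk b) := by
  refine ⟨(p : ℚ) ^ m, fun n ↦ ?_⟩
  rw [coeff_mk]
  by_cases hb : b n = 0
  · rw [hb, padicNorm.zero]
    positivity
  rw [padicNorm.eq_zpow_of_nonzero hb, ← zpow_natCast]
  refine zpow_le_zpow_right₀ (by exact_mod_cast hp.out.one_le) ?_
  have h1 : padicValNat p (b n).den < m := by
    by_contra! hm
    exact h n ((pow_dvd_pow p hm).trans pow_padicValNat_dvd)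
  rw [padicValRat]
  lia

/-- On an integral series `φ` multiplies each coefficient by `φ 1`. A complex scalar `c` is absorbed
by replacing `φ` with `φ (c * ·)`, hence the induction over all `φ`. -/
lemma pBounded_of_mem_intSpan {P : ℂ⟦X⟧} (hP : P ∈ intSpan) (φ : ℂ →ₗ[ℚ] ℚ) :
    PBounded p (PowerSeries.mk fun n ↦ φ (P.coeff n)) := by
  refine intSpan_induction (p := fun P ↦ ∀ φ : ℂ →ₗ[ℚ] ℚ,
    PBounded p (PowerSeries.mk fun n ↦ φ (P.coeff n))) (fun P φ ↦ ?_) (fun φ ↦ ?_)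
    (fun P Q hP hQ φ ↦ ?_) (fun c P hP φ ↦ ?_) hP φ
  · refine ⟨padicNorm p (φ 1), fun n ↦ ?_⟩
    have : φ ((P.coeff n : ℤ) : ℂ) = (P.coeff n : ℤ) * φ 1 := by
      rw [← zsmul_one, map_zsmul, zsmul_eq_mul]
    simp only [coeff_mk, coeff_map, eq_intCast, this, padicNorm.mul]
    exact mul_le_of_le_one_left (padicNorm.nonneg _) (padicNorm.of_int _)
  · exact ⟨0, fun n ↦ by simp⟩
  · convert! (hP φ).add (hQ φ) using 1
    ext n
    simp
  · exact hP (φ ∘ₗ (LinearMap.mulLeft ℚ c))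

/-- If the `p`-adic absolute values of the coefficients `a n` grow at least as fast as those of
`1 / (pⁿ n!)`, then no nonzero `p`-bounded multiple of `∑ a n Xⁿ` is `p`-bounded. -/
lemma not_pBounded_mul {a : ℕ → ℚ} (ha₀ : a 0 ≠ 0)
    (ha : ∀ n : ℕ, p * padicNorm p (a n) ≤ padicNorm p ((n + 1 : ℕ) : ℚ) * padicNorm p (a (n + 1)))
    {P : ℚ⟦X⟧} (hP : PBounded p P) (hP0 : P ≠ 0) : ¬ PBounded p (P * PowerSeries.mk a) := by
  rintro ⟨B, hB⟩
  obtain ⟨C, hC⟩ := hP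
  have hp1 : (1 : ℚ) < p := by exact_mod_cast hp.out.one_lt
  have hstep (n : ℕ) : p * padicNorm p (a n) ≤ padicNorm p (a (n + 1)) :=
    (ha n).trans (mul_le_of_le_one_left (padicNorm.nonneg _) (by exact_mod_cast padicNorm.of_nat _))
  have hmono : Monotone fun n ↦ padicNorm p (a n) := monotone_nat_of_le_succ fun n ↦
    (le_mul_of_one_le_left (padicNorm.nonneg _) hp1.le).trans (hstep n)
  have hgrow (n : ℕ) : (p : ℚ) ^ n * padicNorm p (a 0) ≤ padicNorm p (a n) := by
    induction n with
    | zero => simp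
    | succ n ih =>
      rw [pow_succ', mul_assoc]
      exact (mul_le_mul_of_nonneg_left ih (by positivity)).trans (hstep n)
  have ha₀' : 0 < padicNorm p (a 0) := (padicNorm.nonneg _).lt_of_ne' (padicNorm.nonzero ha₀)
  classical
  have hex : ∃ s, P.coeff s ≠ 0 := by
    by_contra! h
    exact hP0 (PowerSeries.ext (by simpa using h))
  set s := Nat.find hex with hs
  have hs0 : P.coeff s ≠ 0 := Nat.find_spec hex
  have hslt (i : ℕ) (hi : i < s) : P.coeff i = 0 := not_not.mp (Nat.find_min hex hi)
  set μ := padicNorm p (P.coeff s) with hμ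
  have hμ0 : 0 < μ := (padicNorm.nonneg _).lt_of_ne' (padicNorm.nonzero hs0)
  have hC0 : 0 ≤ C := (padicNorm.nonneg _).trans (hC 0)
  -- With `s` the order of `P`, the coefficient of index `s + p ^ t` is dominated by `P_s * a (p ^
  -- t)`. The first bound on `t` makes the other terms smaller, the second makes this term exceed
  -- `B`.
  obtain ⟨t, ht⟩ := pow_unbounded_of_one_lt (max (C / μ) (B / (μ * padicNorm p (a 0)))) hp1
  have htC : C < (p : ℚ) ^ t * μ := (div_lt_iff₀ hμ0).mp ((le_max_left _ _).trans_lt ht)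
  have htB : B < (p : ℚ) ^ t * (μ * padicNorm p (a 0)) :=
    (div_lt_iff₀ (mul_pos hμ0 ha₀')).mp ((le_max_right _ _).trans_lt ht)
  obtain ⟨n, hn⟩ : ∃ n, p ^ t = n + 1 :=
    ⟨p ^ t - 1, (Nat.sub_add_cancel (Nat.one_le_pow _ _ hp.out.pos)).symm⟩
  have hlead : B < μ * padicNorm p (a (n + 1)) := by
    have h1 : (p : ℚ) ^ t ≤ (p : ℚ) ^ (n + 1) :=
      pow_le_pow_right₀ hp1.le (hn ▸ (Nat.lt_pow_self hp.out.one_lt).le)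
    calc B < (p : ℚ) ^ t * (μ * padicNorm p (a 0)) := htB
      _ = μ * ((p : ℚ) ^ t * padicNorm p (a 0)) := by ring
      _ ≤ μ * ((p : ℚ) ^ (n + 1) * padicNorm p (a 0)) := by gcongr
      _ ≤ μ * padicNorm p (a (n + 1)) := by
        gcongr
        exact hgrow _
  have hpos : 0 < padicNorm p (a (n + 1)) :=
    (mul_pos (by positivity) ha₀').trans_le (hgrow (n + 1))
  -- Here `n + 1 = p ^ t`, so the growth hypothesis gains a factor `p ^ t`; by monotonicity this
  -- also controls all earlier `a j`.
  have hprev : C * padicNorm p (a n) < μ * padicNorm p (a (n + 1)) := by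
    have h1 := ha n
    have h2 : padicNorm p ((n + 1 : ℕ) : ℚ) = ((p : ℚ) ^ t)⁻¹ := by
      rw [← hn, padicNorm.eq_zpow_of_nonzero (by exact_mod_cast (pow_pos hp.out.pos t).ne')]
      simp
    rw [h2] at h1
    have hpt : (0 : ℚ) < (p : ℚ) ^ t := by positivity
    have h3 : (p : ℚ) ^ t * padicNorm p (a n) ≤ padicNorm p (a (n + 1)) := by
      have h4 := mul_le_mul_of_nonneg_left h1 hpt.le
      rw [mul_inv_cancel_left₀ hpt.ne'] at h4
      refine le_trans ?_ h4
      gcongr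
      exact le_mul_of_one_le_left (padicNorm.nonneg _) hp1.le
    rcases (padicNorm.nonneg (p := p) (a n)).eq_or_lt with h0 | h0
    · rw [← h0, mul_zero]
      positivity
    · calc C * padicNorm p (a n) < (p : ℚ) ^ t * μ * padicNorm p (a n) := by gcongr
        _ = μ * ((p : ℚ) ^ t * padicNorm p (a n)) := by ring
        _ ≤ _ := by gcongr
  have hmem : (s, n + 1) ∈ Finset.HasAntidiagonal.antidiagonal (s + (n + 1)) := by simp
  have hsum := coeff_mul (s + (n + 1)) P (PowerSeries.mk a)
  rw [← Finset.add_sum_erase _ _ hmem] at hsum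
  have hrest : padicNorm p (∑ q ∈ (Finset.HasAntidiagonal.antidiagonal (s + (n + 1))).erase (s, n + 1),
      P.coeff q.1 * (PowerSeries.mk a).coeff q.2) < μ * padicNorm p (a (n + 1)) := by
    refine padicNorm.sum_lt' (fun ⟨i, j⟩ hq ↦ ?_) (by positivity)
    obtain ⟨hne, hij⟩ := Finset.mem_erase.mp hq
    have hij' : i + j = s + (n + 1) := by simpa using hij
    simp only [coeff_mk, padicNorm.mul]
    rcases lt_trichotomy i s with hi | hi | hi
    · rw [hslt i hi, padicNorm.zero, zero_mul]
      positivity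
    · exact absurd (Prod.ext hi (by simp only; lia)) hne
    · refine lt_of_le_of_lt ?_ hprev
      exact mul_le_mul (hC i) (hmono (by lia)) (padicNorm.nonneg _) hC0
  have hfin : μ * padicNorm p (a (n + 1)) ≤ max (padicNorm p ((P * PowerSeries.mk a).coeff
      (s + (n + 1)))) (padicNorm p (∑ q ∈ (Finset.HasAntidiagonal.antidiagonal (s + (n + 1))).erase (s, n + 1),
      P.coeff q.1 * (PowerSeries.mk a).coeff q.2)) := by
    rw [hμ, ← padicNorm.mul]
    refine le_trans (le_of_eq ?_) padicNorm.sub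
    congr 1
    rw [hsum, coeff_mk]
    ring
  exact absurd hfin (not_le.mpr (max_lt ((hB _).trans_lt hlead) hrest))

lemma lam_pos {d : ℕ} [NeZero d] {N : ℕ} {A : Fin d → ℕ} (hA : ∀ i, A i < N) (n : ℕ) :
    0 < lam N A (n + 1) := by
  refine Finset.prod_pos fun i _ ↦ ?_
  have h1 : (A i : ℤ) < N := by exact_mod_cast hA i
  have h2 : (0 : ℤ) ≤ A 0 := by positivity
  have h3 : (0 : ℤ) ≤ N * n := by positivity
  push_cast
  linarith

/-- The valuation drops from `a n` to `a (n + 1)` by `-δ + ν(n + 1) + ν(λ(n + 1))`, where `-δ ≥ 1`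
and `λ(n + 1)` is a nonzero integer. No `a n` is zero: the convention `ν(0) = 0` would contradict `n
* δ < 0`. -/
lemma growth_of_padicValRat {d : ℕ} [NeZero d] {N : ℕ} {A : Fin d → ℕ} (hA : ∀ i, A i < N)
    {a : ℕ → ℚ} (ha₀ : a 0 = 1) {δ : ℤ} (hδ : δ < 0)
    (hord : ∀ n : ℕ, 1 ≤ n → padicValRat p (a n) =
      n * δ - padicValInt p (∏ k ∈ Finset.Icc 1 n, (k : ℤ) * lam N A k)) (n : ℕ) :
    p * padicNorm p (a n) ≤ padicNorm p ((n + 1 : ℕ) : ℚ) * padicNorm p (a (n + 1)) := by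
  have hord' (n : ℕ) : padicValRat p (a n) =
      n * δ - padicValInt p (∏ k ∈ Finset.Icc 1 n, (k : ℤ) * lam N A k) := by
    rcases Nat.eq_zero_or_pos n with rfl | hn
    · simp [ha₀]
    · exact hord n hn
  have hne (n : ℕ) : a n ≠ 0 := by
    rcases Nat.eq_zero_or_pos n with rfl | hn
    · simp [ha₀]
    · intro h
      have := hord n hn
      rw [h, padicValRat.zero] at this
      have h2 : (n : ℤ) * δ < 0 := mul_neg_of_pos_of_neg (by exact_mod_cast hn) hδ
      lia
  have hpos (n : ℕ) : ∏ k ∈ Finset.Icc 1 n, (k : ℤ) * lam N A k ≠ 0 := by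
    refine Finset.prod_ne_zero_iff.mpr fun k hk ↦ ?_
    obtain ⟨m, rfl⟩ := Nat.exists_eq_succ_of_ne_zero (Nat.one_le_iff_ne_zero.mp
      (Finset.mem_Icc.mp hk).1)
    exact mul_ne_zero (by positivity) (lam_pos hA m).ne'
  have hval : padicValRat p (a (n + 1)) + padicValRat p ((n + 1 : ℕ) : ℚ) + 1 ≤
      padicValRat p (a n) := by
    rw [hord', hord', Finset.prod_Icc_succ_top (by lia), padicValInt.mul (hpos n)
      (mul_ne_zero (by positivity) (lam_pos hA n).ne'), padicValInt.mul (by positivity)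
      (lam_pos hA n).ne', padicValRat.of_nat, padicValInt.of_nat]
    push_cast
    linarith [(Nat.cast_nonneg (padicValInt p (lam N A (n + 1))) : (0 : ℤ) ≤ _)]
  have hp0 : (p : ℚ) ≠ 0 := by exact_mod_cast hp.out.ne_zero
  rw [padicNorm.eq_zpow_of_nonzero (hne n), padicNorm.eq_zpow_of_nonzero (hne (n + 1)),
    padicNorm.eq_zpow_of_nonzero (by positivity), ← zpow_one_add₀ hp0, ← zpow_add₀ hp0]
  exact zpow_le_zpow_right₀ (by exact_mod_cast hp.out.one_le) (by linarith)

end Padic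

end VVMF

/-! ### Descent of the relation to `ℚ` and conclusion. -/

namespace VVMF

open Derivative PowerSeries

lemma hasQSeries_zero (r : ℝ) : HasQSeries r 0 (fun _ ↦ 0) := by
  intro τ
  simp

lemma HasQSeries.sum {ι : Type*} {s : Finset ι} {r : ℝ} {f : ι → ℍ → ℂ} {P : ι → ℂ⟦X⟧}
    (h : ∀ t ∈ s, HasQSeries r (f t) ((P t).coeff ·)) :
    HasQSeries r (∑ t ∈ s, f t) ((∑ t ∈ s, P t).coeff ·) := by
  classical
  induction s using Finset.induction_on with
  | empty => exact (hasQSeries_zero r).congr rfl (by simp)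
  | insert t s ht ih =>
    rw [Finset.sum_insert ht, Finset.sum_insert ht]
    exact ((h t (Finset.mem_insert_self _ _)).add
      (ih fun u hu ↦ h u (Finset.mem_insert_of_mem hu))).congr rfl (by simp)

lemma HasQSeries.iterate_vecDeriv {d : ℕ} {F : ℍ → Fin d → ℂ} {i : Fin d} {r : ℝ} {b : ℕ → ℂ}
    (h : HasQSeries r (fun τ ↦ F τ i) b) (j : ℕ) :
    HasQSeries r (fun τ ↦ vecDeriv^[j] F τ i) (fun n ↦ (r + n) ^ j * b n) := by
  induction j with
  | zero => simpa using h
  | succ j ih =>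
    rw [Function.iterate_succ_apply']
    exact ih.normalizedDeriv.congr rfl fun n ↦ by ring

lemma mk_linearMap_coeff_mul_map (φ : ℂ →ₗ[ℚ] ℚ) (P : ℂ⟦X⟧) (q : ℚ⟦X⟧) :
    PowerSeries.mk (fun n ↦ φ ((P * PowerSeries.map (Rat.castHom ℂ) q).coeff n)) =
      PowerSeries.mk (fun n ↦ φ (P.coeff n)) * q := by
  ext n
  simp only [coeff_mk, coeff_mul, coeff_map, map_sum]
  refine Finset.sum_congr rfl fun x _ ↦ ?_
  rw [eq_ratCast, mul_comm, ← Rat.smul_def, map_smul, smul_eq_mul, mul_comm]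

/-- A relation with coefficients in `qAlg` between functions with rational `q`-series descends to a
relation between these series with `p`-bounded rational coefficients. -/
lemma exists_rational_relation {ι : Type*} [Fintype ι] {p : ℕ} [Fact p.Prime] {r : ℝ}
    {Q f : ℍ → ℂ} {R g : ι → ℍ → ℂ} {a : ℚ⟦X⟧} {b : ι → ℚ⟦X⟧} (hQ : Q ∈ qAlg) (hQ0 : Q ≠ 0)
    (hR : ∀ t, R t ∈ qAlg) (hf : HasQSeries r f (fun n ↦ (a.coeff n : ℂ)))
    (hg : ∀ t, HasQSeries r (g t) (fun n ↦ ((b t).coeff n : ℂ)))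
    (h : Q * f = ∑ t, R t * g t) :
    ∃ P : ℚ⟦X⟧, PBounded p P ∧ P ≠ 0 ∧
      ∃ S : ι → ℚ⟦X⟧, (∀ t, PBounded p (S t)) ∧ P * a = ∑ t, S t * b t := by
  obtain ⟨-, P, hP, hQP⟩ := hQ
  choose hRd S hS hRS using hR
  have hf' : HasQSeries r f ((PowerSeries.map (Rat.castHom ℂ) a).coeff ·) :=
    hf.congr rfl (by simp)
  have hg' (t : ι) : HasQSeries r (g t) ((PowerSeries.map (Rat.castHom ℂ) (b t)).coeff ·) :=
    (hg t).congr rfl (by simp)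
  have hl := hQP.mul hf'
  have hr := HasQSeries.sum (s := Finset.univ) fun t _ ↦ (hRS t).mul (hg' t)
  rw [h] at hl
  have heq : P * PowerSeries.map (Rat.castHom ℂ) a =
      ∑ t, S t * PowerSeries.map (Rat.castHom ℂ) (b t) := PowerSeries.ext fun n ↦ hl.unique hr n
  obtain ⟨m, hm⟩ : ∃ m, P.coeff m ≠ 0 := by
    by_contra! hz
    refine hQ0 (funext fun τ ↦ (hQP τ).unique ?_)
    simpa only [hz, zero_mul, Pi.zero_apply] using hasSum_zero
  -- `φ` is chosen not to kill a nonzero coefficient of `P`, so that the descended relation is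
  -- nontrivial.
  obtain ⟨φ, hφ⟩ : ∃ φ : ℂ →ₗ[ℚ] ℚ, φ (P.coeff m) ≠ 0 := by
    by_contra! hz
    exact hm ((Module.forall_dual_apply_eq_zero_iff ℚ _).mp hz)
  refine ⟨_, pBounded_of_mem_intSpan hP φ, fun hz ↦ hφ ?_, _,
    fun t ↦ pBounded_of_mem_intSpan (hS t) φ, ?_⟩
  · simpa using congrArg (coeff m) hz
  · simp only [← mk_linearMap_coeff_mul_map, heq]
    ext n
    simp

lemma isPUBD_of_ne_zero {d : ℕ} [NeZero d] {ρ : SL(2, ℤ) →* GL (Fin d) ℂ}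
    (hirr : (toRepresentation ρ).IsIrreducible) {N : ℕ} (hN : 0 < N)
    (hT : ρ ModularGroup.T ^ N = 1) {A : Fin d → ℕ} (hA : ∀ i, A i < N)
    {k₀ : ℤ} {F₀ : ℍ → Fin d → ℂ} (hF₀ : F₀ ∈ formSpace ρ k₀)
    (hcyc : formModule ρ = cyclicModule k₀ F₀) {a : ℕ → ℚ} (ha₀ : a 0 = 1)
    (ha : HasQSeries ((A 0 : ℝ) / N) (fun τ ↦ F₀ τ 0) (fun n ↦ (a n : ℂ)))
    {p : ℕ} (hp : p.Prime) {δ : ℤ} (hδ : δ < 0)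
    (hord : ∀ n : ℕ, 1 ≤ n → padicValRat p (a n) =
      n * δ - padicValInt p (∏ k ∈ Finset.Icc 1 n, (k : ℤ) * lam N A k))
    {F : ℍ → Fin d → ℂ} (hF : F ∈ rationalForms ρ (fun i ↦ (A i : ℝ) / N)) (hF0 : F ≠ 0) :
    IsPUBD p (fun i ↦ (A i : ℝ) / N) F := by
  have : Fact p.Prime := ⟨hp⟩
  obtain ⟨hFm, b, hb⟩ := hF
  -- The unbounded component is always the first, the one for which the growth of `F₀` is known.
  refine ⟨b, hb, 0, ?_⟩
  by_contra! hbdd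
  obtain ⟨m, hm⟩ := hbdd
  -- The point `I` is arbitrary; it only shows that the determinant is not identically zero.
  obtain ⟨r, hr⟩ := exists_det_iterate_vecDeriv_ne_zero hirr hN hT hFm hF0 I
  obtain ⟨Q, hQ, hQ0, R, hR, hrel⟩ := exists_relation
    (fun t ↦ iterate_vecDeriv_mem_vecSpan hcyc (formModule_le_vecSpan hFm) (r t))
    (formSpace_le_vecSpan k₀ hF₀) hr
  obtain ⟨P, hP, hP0, S, hS, hPS⟩ := exists_rational_relation (p := p) hQ hQ0 hR
    (f := fun τ ↦ F₀ τ 0) (g := fun t τ ↦ vecDeriv^[r t] F τ 0) (r := (A 0 : ℝ) / N)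
    (a := PowerSeries.mk a)
    (b := fun t ↦ PowerSeries.mk fun n ↦ ((A 0 : ℚ) / N + n) ^ r t * b 0 n)
    (ha.congr rfl (by simp))
    (fun t ↦ ((hb 0).iterate_vecDeriv (r t)).congr rfl (by simp))
    (by
      ext τ
      rw [Pi.mul_apply, hrel, Finset.sum_apply]
      rfl)
  refine not_pBounded_mul (p := p) (by simp [ha₀]) (growth_of_padicValRat hA ha₀ hδ hord) hP hP0 ?_
  rw [hPS]
  exact PBounded.sum fun t _ ↦ (hS t).mul ((pBounded_of_not_dvd_den hm).euler _ _)

lemma zero_mem_pBoundedForms {d : ℕ} (ρ : SL(2, ℤ) →* GL (Fin d) ℂ) {p : ℕ} (hp : p.Prime)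
    (r : Fin d → ℝ) : 0 ∈ pBoundedForms ρ p r := by
  refine ⟨⟨Submodule.zero_mem _, fun _ _ ↦ 0, fun i ↦ (hasQSeries_zero _).congr rfl (by simp)⟩, ?_⟩
  rintro ⟨a, ha, i, hi⟩
  obtain ⟨n, hn⟩ := hi 1
  have h0 : a i n = 0 := by
    have := (ha i).eq_zero n
    exact_mod_cast this
  rw [h0, pow_one, Rat.den_zero] at hn
  exact hp.one_lt.ne' (Nat.dvd_one.mp hn)

end VVMF

theorem proposition4p3 {d : ℕ} [NeZero d] (ρ : SL(2, ℤ) →* GL (Fin d) ℂ)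
    (hirr : (VVMF.toRepresentation ρ).IsIrreducible)
    (N : ℕ) (hN : 0 < N) (hlevel : orderOf (ρ ModularGroup.T) = N)
    (A : Fin d → ℕ) (hA : ∀ i, A i < N)
    (hT : (ρ ModularGroup.T : Matrix (Fin d) (Fin d) ℂ) =
      Matrix.diagonal fun i ↦ Complex.exp (2 * Real.pi * Complex.I * ((A i : ℂ) / N)))
    (k₀ : ℤ) (F₀ : ℍ → Fin d → ℂ) (hF₀ : F₀ ∈ VVMF.formSpace ρ k₀)
    (hcyc : VVMF.formModule ρ = VVMF.cyclicModule k₀ F₀)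
    (a : ℕ → ℚ) (ha₀ : a 0 = 1)
    (ha : VVMF.HasQSeries ((A 0 : ℝ) / N) (fun τ ↦ F₀ τ 0) (fun n ↦ (a n : ℂ)))
    (p : ℕ) (hp : p.Prime) (δ : ℤ) (hδ : δ < 0)
    (hord : ∀ n : ℕ, 1 ≤ n →
      padicValRat p (a n) =
        n * δ - padicValInt p (∏ k ∈ Finset.Icc 1 n, (k : ℤ) * VVMF.lam N A k)) :
    VVMF.pBoundedForms ρ p (fun i ↦ (A i : ℝ) / N) = {0} ∧
      ∀ F ∈ VVMF.rationalForms ρ (fun i ↦ (A i : ℝ) / N),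
        F ≠ 0 → VVMF.IsPUBD p (fun i ↦ (A i : ℝ) / N) F := by
  have hpow : ρ ModularGroup.T ^ N = 1 := hlevel ▸ pow_orderOf_eq_one _
  have hmain : ∀ F ∈ VVMF.rationalForms ρ (fun i ↦ (A i : ℝ) / N),
      F ≠ 0 → VVMF.IsPUBD p (fun i ↦ (A i : ℝ) / N) F := fun F hF hF0 ↦
    VVMF.isPUBD_of_ne_zero hirr hN hpow hA hF₀ hcyc ha₀ ha hp hδ hord hF hF0
  refine ⟨Set.Subset.antisymm (fun F hF ↦ ?_) ?_, hmain⟩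
  · by_contra hF0
    exact hF.2 (hmain F hF.1 hF0)
  · rintro _ rfl
    exact VVMF.zero_mem_pBoundedForms ρ hp _
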